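/- **Setting.** Fix integers $N\ge 0$, $N_t,N_r,d\ge 1$ with $d\le\min(N_t,N_r)$, $B\ge 0$, and reals $\theta,\tau,R,\sigma,\zeta,P>0$ with $N\theta<1$. Put $\alpha=P\zeta/d$, $Q=N_tN_r-1$, $\breve a=\frac{(Q+1)d}{Q}-\frac1Q$, $\breve b=(Q-1)\breve a$, $ma=\max(N_t,N_r)$, $mi=\min(N_t,N_r)$. In each slot $t=0,1,\dots$ a scheduler, knowing the queue lengths $q(t)\in\mathbb R_+^N$, either uses interference alignment (IA) with a set $\mathcal L\subseteq\{1,\dots,N\}$ of active pairs, or TDMA-SVD with exactly one active pair. With $L$ active pairs, an active pair $k$ is served $B_k(t)=(1-L\theta)R\cdot\#\{m\le d:\gamma_k^{(m)}\ge\tau\}$ bits, and an inactive pair $0$ bits. The SINRs follow the statistical model $$\gamma_k^{(m)}=\frac{\alpha G}{\sigma^2+\sum_{i\in\mathcal L,i\ne k}\alpha d\,X_iY_i}\ (\text{IA, imperfect}),\quad \gamma_k^{(m)}=\frac{\alpha G}{\sigma^2}\ (\text{IA, perfect}),\quad \gamma_k^{(m)}=\frac{\zeta P}{N_t\sigma^2}\lambda\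 (\text{TDMA-SVD}),$$ with $G\sim\mathrm{Exp}(1)$, $X_i\sim\mathrm{Gamma}(Q,2^{B/Q})$ (shape, rate), $Y_i\sim\mathrm{Beta}(\breve a,\breve b)$, all independent for given $\mathcal L,k,m$, and $\lambda$ with density $\frac1{mi}\sum_{n=0}^{mi-1}\frac{n!}{(n+ma-mi)!}[L_n^{ma-mi}(\lambda)]^2\lambda^{ma-mi}e^{-\lambda}$ on $\lambda\ge0$, where $L_n^{ma-mi}(\lambda)=\sum_{l=0}^n\omega_{n,l}\lambda^l$, $\omega_{n,l}=(-1)^l\frac{(n+ma-mi)!}{(n-l)!\,(ma-mi+l)!\,l!}$, and $\omega_{n,l}=0$ for $l>n$. In the imperfect case assume $N_tN_r\ge 3$, so that $\breve b>0$. The fading is independent over slots. Queues evolve by $q_k(t+1)=\max\{q_k(t)-B_k(t),0\}+A_k(t)$ from any deterministic $q(0)\ge 0$. The arrivals are bounded and nonnegative, independent across users, identically distributed over slots with mean vector $a$, and the pairs (arrivals, fading) are independent over slots. The system is strongly stable if $\limsup_T\frac1T\sum_{t<T}\mathbb E[q_k(t)]<\infty$ for every $k$. The stability region of a policy is the set of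 $a\in\mathbb R^N_+$ such that the system is strongly stable for every arrival process with mean $a$ and every $q(0)$. **Rates.** Let $F=\big(\tfrac{d\tau}{2^{B/Q}}+1\big)^{-Q}{}_2F_1\big(\breve b,Q;\breve a+\breve b;\tfrac{1}{2^{B/Q}/(d\tau)+1}\big)$, $$r(L)=(1-L\theta)dRe^{-\sigma^2\tau/\alpha}F^{L-1},\qquad \mu(L)=(1-L\theta)dRe^{-\sigma^2\tau/\alpha},$$ $$r_{\rm svd}=(1-\theta)dR\sum_{n=0}^{mi-1}\Omega_n\sum_{j=0}^{2n}\kappa_{n,j}\,\Gamma\Big(j+ma-mi+1,\tfrac{N_t\sigma^2\tau}{\zeta P}\Big),$$ where $\Omega_n=\frac{n!}{mi\,(n+ma-mi)!}$, $\kappa_{n,j}=\sum_{i=0}^j\omega_{n,i}\omega_{n,j-i}$ and $\Gamma(\cdot,\cdot)$ is the upper incomplete Gamma function. Let $$L_0=\tfrac12\Big(\tfrac1\theta-\tfrac2{\log F}-\sqrt{(\tfrac2{\log F}-\tfrac1\theta)^2+\tfrac4{\theta\log F}}\Big).$$ $L_{\rm I}$ is the one of $\lfloor L_0\rfloor,\lceil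 L_0\rceil$ with the larger value of $L\,r(L)$, and $L_{\rm P}$ the one of $\lfloor\frac1{2\theta}\rfloor,\lceil\frac1{2\theta}\rceil$ with the larger value of $L\,\mu(L)$ (ties go to the ceiling). Let $S_L=\{s\in\{0,1\}^N:\|s\|_1=L\}$, $I_L=\{r(L)s:s\in S_L\}$, $P_L=\{\mu(L)s:s\in S_L\}$ (empty for $L>N$), $J_1=\{r_{\rm svd}\,s:s\in S_1\}$, and let $\mathcal{CH}$ be the closed convex hull. **Theorem.** Consider a switching policy: in every queue state $q$ it uses the technique, and the active pairs, attaining $$\max\Big\{\max_{s\in\{0,1\}^N}r(\|s\|_1)\,s\cdot q,\ \max_{s\in S_1}r_{\rm svd}\,s\cdot q\Big\}$$ in the imperfect case of IA, with $\mu$ in place of $r$ in the perfect case (ties broken arbitrarily but measurably). Its stability region is characterized by $$\Lambda=\mathcal{CH}\{0,I_1,\dots,I_{L_{\rm I}},J_1\}\ \text{(imperfect case)},\qquad \Lambda=\mathcal{CH}\{0,P_1,\dots,P_{L_{\rm P}},J_1\}\ \text{(perfect case)}.$$ That is, every $a$ in the interior of $\Lambda$ relative to $\mathbb R_+^N$ belongs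 to the stability region of the policy, and that region is contained in $\Lambda$. Moreover, if the system is strongly stable under some measurable policy whose decision is a function of the queue lengths, for some arrival process with mean vector $a$ and some $q(0)\ge0$, then $a\in\Lambda$. -/

import Mathlib

open MeasureTheory ProbabilityTheory Filter Topology

noncomputable section

namespace IASVD

/-! ### Parameters of the symmetric MIMO interference network -/

/-- Parameters of the symmetric network. -/
structure Params where
  /-- number of transmitter-receiver pairs -/
  N : ℕ
  /-- antennas at each transmitter -/
  Nt : ℕ
  /-- antennas at each receiver -/
  Nr : ℕ
  /-- data streams per pair -/
  d : ℕ
  /-- quantization bits per channel matrix (limited backhaul only) -/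
  B : ℕ
  /-- fraction of a slot needed to acquire the CSI of one active user -/
  θ : ℝ
  /-- SINR threshold -/
  τ : ℝ
  /-- bits per slot assigned to a stream whose SINR reaches the threshold -/
  R : ℝ
  /-- noise standard deviation -/
  σ : ℝ
  /-- common path loss coefficient -/
  ζ : ℝ
  /-- transmit power -/
  P : ℝ

/-- Standing assumptions on the parameters. -/
structure Params.Valid (p : Params) : Prop where
  one_le_d : 1 ≤ p.d
  d_le : p.d ≤ min p.Nt p.Nr
  θ_pos : 0 < p.θ
  Nθ_lt : (p.N : ℝ) * p.θ < 1
  τ_pos : 0 < p.τ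
  R_pos : 0 < p.R
  σ_pos : 0 < p.σ
  ζ_pos : 0 < p.ζ
  P_pos : 0 < p.P

/-- The two cases for interference alignment: limited backhaul (quantized CSI) or unlimited
backhaul (perfect global CSI). -/
inductive Backhaul
  | imperfect
  | perfect

variable (p : Params)

/-- `α = P ζ / d`. -/
def Params.α : ℝ := p.P * p.ζ / p.d

/-- `Q = N_t N_r - 1`. -/
def Params.Q : ℕ := p.Nt * p.Nr - 1

/-- `δ = 2 ^ (B / Q)`. -/
def Params.δ : ℝ := (2 : ℝ) ^ ((p.B : ℝ) / (p.Q : ℝ))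

/-- `ă = (Q + 1) d / Q - 1 / Q`. -/
def Params.aBeta : ℝ := ((p.Q : ℝ) + 1) * p.d / p.Q - 1 / p.Q

/-- `b̆ = (Q - 1) ă`. -/
def Params.bBeta : ℝ := ((p.Q : ℝ) - 1) * p.aBeta

/-! ### Average rates of interference alignment (IA) -/

/-- `F = (d τ / 2^{B/Q} + 1)^{-Q} ₂F₁(b̆, Q; ă + b̆; 1 / (2^{B/Q} / (d τ) + 1))`. -/
def Params.F : ℝ :=
  ((p.d * p.τ / p.δ + 1) ^ p.Q)⁻¹ *
    ordinaryHypergeometric p.bBeta (p.Q : ℝ) (p.aBeta + p.bBeta)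
      (1 / (p.δ / (p.d * p.τ) + 1))

/-- Average rate of an active pair in the imperfect case when `L` pairs are active:
`r(L) = (1 - L θ) d R e^{-σ² τ / α} F^{L-1}` (used only for `1 ≤ L`). -/
def Params.r (L : ℕ) : ℝ :=
  (1 - L * p.θ) * p.d * p.R * Real.exp (-(p.σ ^ 2 * p.τ / p.α)) * p.F ^ (L - 1)

/-- Average rate of an active pair in the perfect case when `L` pairs are active:
`μ(L) = (1 - L θ) d R e^{-σ² τ / α}`. -/
def Params.mu (L : ℕ) : ℝ :=
  (1 - L * p.θ) * p.d * p.R * Real.exp (-(p.σ ^ 2 * p.τ / p.α))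

/-- The average rate of IA with `L` active pairs: `r(L)` or `μ(L)`. -/
def Params.iaRate : Backhaul → ℕ → ℝ
  | .imperfect => p.r
  | .perfect => p.mu

/-- The real number at which `L ↦ L r(L)` is maximal. -/
def Params.L0 : ℝ :=
  (1 / p.θ - 2 / Real.log p.F
    - Real.sqrt ((2 / Real.log p.F - 1 / p.θ) ^ 2 + 4 / (p.θ * Real.log p.F))) / 2

/-- The better (for the objective `f`) of the two integers `⌊x⌋`, `⌈x⌉`; ties go to `⌈x⌉`. -/
def bestInteger (f : ℕ → ℝ) (x : ℝ) : ℕ :=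
  if f ⌊x⌋₊ ≤ f ⌈x⌉₊ then ⌈x⌉₊ else ⌊x⌋₊

/-- `L_I`: the best of the two integers nearest to `L₀`, for the total rate `L r(L)`. -/
def Params.LI : ℕ := bestInteger (fun L => (L : ℝ) * p.r L) p.L0

/-- `L_P`: the best of the two integers nearest to `1 / (2 θ)`, for the total rate `L μ(L)`. -/
def Params.LP : ℕ := bestInteger (fun L => (L : ℝ) * p.mu L) (1 / (2 * p.θ))

/-! ### Average rate of TDMA-SVD -/

/-- Upper incomplete Gamma function `Γ(s, x) = ∫_x^∞ t^{s-1} e^{-t} dt`. -/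
def upperGamma (s x : ℝ) : ℝ := ∫ t in Set.Ioi x, t ^ (s - 1) * Real.exp (-t)

/-- `ma = max(N_t, N_r)`. -/
def Params.ma : ℕ := max p.Nt p.Nr

/-- `mi = min(N_t, N_r)`. -/
def Params.mi : ℕ := min p.Nt p.Nr

/-- Coefficient of `λ^l` in the associated Laguerre polynomial `L_n^{ma-mi}(λ)`. -/
def Params.lagCoeff (n l : ℕ) : ℝ :=
  if l ≤ n then
    (-1) ^ l * ((n + (p.ma - p.mi)).factorial : ℝ) /
      (((n - l).factorial : ℝ) * ((p.ma - p.mi + l).factorial : ℝ) * (l.factorial : ℝ))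
  else 0

/-- `Ω_n = n! / (mi (n + ma - mi)!)`. -/
def Params.Omega (n : ℕ) : ℝ :=
  (n.factorial : ℝ) / ((p.mi : ℝ) * ((n + (p.ma - p.mi)).factorial : ℝ))

/-- `κ_j = ∑_{i ≤ j} ω_i ω_{j-i}`, the coefficient of `λ^j` in `L_n^{ma-mi}(λ)²`. -/
def Params.kappa (n j : ℕ) : ℝ :=
  ∑ i ∈ Finset.range (j + 1), p.lagCoeff n i * p.lagCoeff n (j - i)

/-- Average rate of the active pair under TDMA-SVD:
`r_svd = (1 - θ) d R ∑_{n < mi} Ω_n ∑_{j ≤ 2n} κ_j Γ(j + ma - mi + 1, N_t σ² τ / (ζ P))`. -/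
def Params.rsvd : ℝ :=
  (1 - p.θ) * p.d * p.R *
    ∑ n ∈ Finset.range p.mi, p.Omega n *
      ∑ j ∈ Finset.range (2 * n + 1), p.kappa n j *
        upperGamma ((j : ℝ) + ((p.ma - p.mi : ℕ) : ℝ) + 1)
          (p.Nt * p.σ ^ 2 * p.τ / (p.ζ * p.P))

/-! ### Fading, SINR and service -/

/-- Associated Laguerre polynomial `L_n^{ma-mi}`. -/
def Params.laguerre (n : ℕ) (x : ℝ) : ℝ :=
  ∑ l ∈ Finset.range (n + 1), p.lagCoeff n l * x ^ l

/-- Density `(1/mi) ∑_{n < mi} n!/(n+ma-mi)! L_n^{ma-mi}(x)² x^{ma-mi} e^{-x}`, `x ≥ 0`, of an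
unordered eigenvalue of `H Hᴴ` (Gram matrix of the smaller dimension), `H` being an
`N_r × N_t` matrix of i.i.d. standard complex Gaussian entries. -/
def Params.eigenDensity (x : ℝ) : ℝ :=
  if 0 ≤ x then
    1 / (p.mi : ℝ) * ∑ n ∈ Finset.range p.mi,
      (n.factorial : ℝ) / ((n + (p.ma - p.mi)).factorial : ℝ) *
        p.laguerre n x ^ 2 * x ^ (p.ma - p.mi) * Real.exp (-x)
  else 0

/-- Law of an unordered eigenvalue. -/
def Params.eigenLaw : Measure ℝ :=
  (volume : Measure ℝ).withDensity fun x => ENNReal.ofReal (p.eigenDensity x)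

/-- The fading variables of one slot. For the set `s` of pairs active under IA, a pair `k`,
a stream `m` and an interfering pair `i`:
* `c.1 s k m` is the direct gain `|u_kᴴ H_kk v_k|²` of stream `m`;
* `c.2.1 s k m i` is the pair `(X, Y)`, with `X = ‖h_ki‖² e_ki` (squared channel norm times
  quantization error) and `d Y` the sum over the `d` interfering streams of the squared
  projections of the quantization error direction;
* `c.2.2 k m` is the eigenvalue carrying stream `m` of pair `k` under TDMA-SVD. -/
abbrev Params.Fading : Type :=
  (Finset (Fin p.N) → Fin p.N → Fin p.d → ℝ) ×
  (Finset (Fin p.N) → Fin p.N → Fin p.d → Fin p.N → ℝ × ℝ) ×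
  (Fin p.N → Fin p.d → ℝ)

instance : MeasurableSpace p.Fading := Prod.instMeasurableSpace

/-- SINR (SNR in the perfect case) of stream `m` of the active pair `k` under IA with active
set `s`. -/
def Params.sinrIA (b : Backhaul) (c : p.Fading) (s : Finset (Fin p.N)) (k : Fin p.N)
    (m : Fin p.d) : ℝ :=
  match b with
  | .imperfect =>
      p.α * c.1 s k m /
        (p.σ ^ 2 + ∑ i ∈ s.erase k, p.α * (c.2.1 s k m i).1 * (p.d * (c.2.1 s k m i).2))
  | .perfect => p.α * c.1 s k m / p.σ ^ 2

/-- SNR of stream `m` of the active pair `k` under TDMA-SVD. -/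
def Params.snrSVD (c : p.Fading) (k : Fin p.N) (m : Fin p.d) : ℝ :=
  p.ζ * p.P / (p.Nt * p.σ ^ 2) * c.2.2 k m

/-- The statistical model of the fading variables of a slot.
* Direct gains are exponential with parameter `1`.
* In the imperfect case the interference variables `(X_i, Y_i)`, over the interfering pairs `i`,
  are mutually independent and independent of the direct gain, with `X_i ~ Gamma(Q, 2^{B/Q})`
  (shape, rate) and `Y_i ~ Beta(ă, b̆)`.
* The eigenvalues used by TDMA-SVD have the density above.
Nothing is assumed on the joint law across pairs, streams or active sets. -/
structure Params.IsSlotFading {Ω : Type*} [MeasurableSpace Ω] (b : Backhaul) (μ : Measure Ω)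
    (c : Ω → p.Fading) : Prop where
  measurable : Measurable c
  gain : ∀ (s : Finset (Fin p.N)), ∀ k ∈ s, ∀ m : Fin p.d,
    HasLaw (fun ω => (c ω).1 s k m) (expMeasure 1) μ
  interference : b = .imperfect → ∀ (s : Finset (Fin p.N)), ∀ k ∈ s, ∀ m : Fin p.d,
    HasLaw
      (fun ω => ((c ω).1 s k m, fun i : {i : Fin p.N // i ∈ s ∧ i ≠ k} => (c ω).2.1 s k m i))
      ((expMeasure 1).prod
        (Measure.pi fun _ => (gammaMeasure (p.Q : ℝ) p.δ).prod (betaMeasure p.aBeta p.bBeta)))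
      μ
  eigen : ∀ (k : Fin p.N) (m : Fin p.d), HasLaw (fun ω => (c ω).2.2 k m) p.eigenLaw μ

/-- A scheduling decision: the technique together with the active pairs. Under IA any set of
pairs may be active, under TDMA-SVD exactly one pair is active. -/
inductive Decision (N : ℕ)
  | ia (s : Finset (Fin N))
  | svd (j : Fin N)

/-- Bits served: `B_k = (1 - L θ) R ×` (number of streams of `k` reaching the threshold) if `k`
is one of the `L` active pairs, and `B_k = 0` otherwise. -/
def Params.service (b : Backhaul) (c : p.Fading) : Decision p.N → Fin p.N → ℝ
  | .ia s, k =>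
      if k ∈ s then
        (1 - (s.card : ℝ) * p.θ) * ∑ m : Fin p.d, (if p.τ ≤ p.sinrIA b c s k m then p.R else 0)
      else 0
  | .svd j, k =>
      if k = j then
        (1 - p.θ) * ∑ m : Fin p.d, (if p.τ ≤ p.snrSVD c k m then p.R else 0)
      else 0

/-! ### Policies and queues -/

/-- A centralized policy: the decision is a function of the queue lengths. -/
abbrev Policy (N : ℕ) : Type := (Fin N → ℝ) → Decision N

/-- Measurability of a policy (there are finitely many decisions). -/
def Policy.IsMeasurable {N : ℕ} (π : Policy N) : Prop :=
  ∀ D : Decision N, MeasurableSet {q | π q = D}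

/-- Max-Weight value of a decision at queue lengths `q`: `r(‖s‖₁) s · q` (resp. `μ(‖s‖₁) s · q`)
for IA with active set `s`, and `r_svd s · q` for TDMA-SVD. -/
def Params.weight (b : Backhaul) (q : Fin p.N → ℝ) : Decision p.N → ℝ
  | .ia s => p.iaRate b s.card * ∑ k ∈ s, q k
  | .svd j => p.rsvd * q j

/-- The switching policy: in every queue state it selects the technique (and its active pairs)
attaining `max {max_{s ∈ S} r(‖s‖₁) s · q, max_{s ∈ S₁} r_svd s · q}`; ties are broken
arbitrarily. -/
def Params.IsSwitchingPolicy (b : Backhaul) (π : Policy p.N) : Prop :=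
  π.IsMeasurable ∧
    ∀ q : Fin p.N → ℝ, (∀ k, 0 ≤ q k) → ∀ D : Decision p.N, p.weight b q D ≤ p.weight b q (π q)

/-- Queue lengths: `q_k(t+1) = max{q_k(t) - B_k(t), 0} + A_k(t)`, from the initial state `q₀`. -/
def Params.queue {Ω : Type*} (b : Backhaul) (c : ℕ → Ω → p.Fading) (π : Policy p.N)
    (A : ℕ → Ω → Fin p.N → ℝ) (q₀ : Fin p.N → ℝ) : ℕ → Ω → Fin p.N → ℝ
  | 0, _ => q₀
  | t + 1, ω => fun k =>
      max (Params.queue b c π A q₀ t ω k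
        - p.service b (c t ω) (π (Params.queue b c π A q₀ t ω)) k) 0 + A t ω k

/-- Strong stability: `limsup_T (1/T) ∑_{t<T} E[q_k(t)] < ∞` for every `k`. -/
def StronglyStable {Ω : Type*} [MeasurableSpace Ω] {N : ℕ} (μ : Measure Ω)
    (q : ℕ → Ω → Fin N → ℝ) : Prop :=
  ∀ k : Fin N,
    limsup (fun T : ℕ => (∑ t ∈ Finset.range T, ∫⁻ ω, ENNReal.ofReal (q t ω k) ∂μ) / (T : ENNReal))
      atTop < ⊤

/-- Arrival processes with mean vector `a`: bounded, nonnegative, independent across users,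
identically distributed in time, and such that (arrivals, fading) are independent from slot to
slot. -/
structure Params.IsArrival {Ω : Type*} [MeasurableSpace Ω] (μ : Measure Ω) (c : ℕ → Ω → p.Fading)
    (a : Fin p.N → ℝ) (A : ℕ → Ω → Fin p.N → ℝ) : Prop where
  measurable : ∀ t, Measurable (A t)
  bounded : ∃ Amax : ℝ, ∀ t k, ∀ᵐ ω ∂μ, 0 ≤ A t ω k ∧ A t ω k < Amax
  users : ∀ t, iIndepFun (fun k ω => A t ω k) μ
  ident : ∀ t k, IdentDistrib (fun ω => A t ω k) (fun ω => A 0 ω k) μ μ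
  mean : ∀ t k, ∫ ω, A t ω k ∂μ = a k
  slots : iIndepFun (fun t ω => (A t ω, c t ω)) μ

/-- Stability region of a policy: the mean arrival rate vectors for which all the queues are
strongly stable. -/
def Params.stabilityRegion {Ω : Type*} [MeasurableSpace Ω] (b : Backhaul) (μ : Measure Ω)
    (c : ℕ → Ω → p.Fading) (π : Policy p.N) : Set (Fin p.N → ℝ) :=
  {a | (∀ k, 0 ≤ a k) ∧
    ∀ (A : ℕ → Ω → Fin p.N → ℝ) (q₀ : Fin p.N → ℝ), p.IsArrival μ c a A → (∀ k, 0 ≤ q₀ k) →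
      StronglyStable μ (p.queue b c π A q₀)}

/-! ### The polytopes -/

/-- Indicator vector of a set of pairs. -/
def indVec {N : ℕ} (s : Finset (Fin N)) : Fin N → ℝ := fun k => if k ∈ s then 1 else 0

/-- `S_L = {s ∈ {0,1}^N : ‖s‖₁ = L}`. -/
def S (N L : ℕ) : Set (Fin N → ℝ) := {x | ∃ s : Finset (Fin N), s.card = L ∧ x = indVec s}

/-- `I_L = {r(L) s : s ∈ S_L}` (imperfect case), `P_L = {μ(L) s : s ∈ S_L}` (perfect case). -/
def Params.iaPoints (b : Backhaul) (L : ℕ) : Set (Fin p.N → ℝ) :=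
  {x | ∃ s ∈ S p.N L, x = p.iaRate b L • s}

/-- `J_1 = {r_svd s : s ∈ S_1}`. -/
def Params.J1 : Set (Fin p.N → ℝ) := {x | ∃ s ∈ S p.N 1, x = p.rsvd • s}

/-- `L_I` in the imperfect case, `L_P` in the perfect case. -/
def Params.Lmax : Backhaul → ℕ
  | .imperfect => p.LI
  | .perfect => p.LP

/-- `CH{I_1, …, I_{L_I}, J_1}` (imperfect case) and `CH{P_1, …, P_{L_P}, J_1}` (perfect case):
closed convex hull; as usual for rate regions the origin (no pair active) is among the points. -/
def Params.region (b : Backhaul) : Set (Fin p.N → ℝ) :=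
  closedConvexHull ℝ
    ({0} ∪ (⋃ L ∈ Finset.Icc 1 (p.Lmax b), p.iaPoints b L) ∪ p.J1)

/-- Interior of `Λ` relative to the nonnegative orthant. -/
def orthantInterior {N : ℕ} (Λ : Set (Fin N → ℝ)) : Set (Fin N → ℝ) :=
  {a | (∀ k, 0 ≤ a k) ∧ Λ ∈ 𝓝[{x | ∀ k, 0 ≤ x k}] a}

/-- `Λ` characterizes the stability region of the switching policy: that policy is strongly stable
in the interior of `Λ`, its stability region is contained in `Λ`, and no centralized policy
whatsoever is strongly stable for a mean arrival rate vector outside `Λ`. -/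
def Params.IsSwitchingRegion {Ω : Type*} [MeasurableSpace Ω] (b : Backhaul) (μ : Measure Ω)
    (c : ℕ → Ω → p.Fading) (Λ : Set (Fin p.N → ℝ)) : Prop :=
  (∀ π : Policy p.N, p.IsSwitchingPolicy b π →
    orthantInterior Λ ⊆ p.stabilityRegion b μ c π ∧ p.stabilityRegion b μ c π ⊆ Λ) ∧
  ∀ (π : Policy p.N) (a : Fin p.N → ℝ) (A : ℕ → Ω → Fin p.N → ℝ) (q₀ : Fin p.N → ℝ),
    π.IsMeasurable → p.IsArrival μ c a A → (∀ k, 0 ≤ q₀ k) →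
      StronglyStable μ (p.queue b c π A q₀) → a ∈ Λ

end IASVD

end

/-!
The mean service of a decision is explicit. Under imperfect interference alignment a stream reaches
the threshold with a probability that is a noise factor times the Laplace transforms of the
interference terms `X Y`. These factorize over the interferers, and the Gamma-Beta integral giving
one factor is Euler's integral for `₂F₁`, after a Pfaff-type change of variables.

Stability inside the region is a drift argument for `∑ q_k²`: every point of the region has
a weight `q · x` at most that of the decision maximizing the weight, so a mean arrival vector which
stays in the region after adding `ε` to each entry forces a drift of at most `C - 2 ε ∑ q_k`.

Conversely, averaging the queue balance over long times at which the mean queues stay bounded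
shows that the mean arrivals are below a limit of averages of the mean services of decisions.
All these mean services lie in the region: beyond `L_I` (or `L_P`) active pairs the total rate
decreases, and the vector `s` with `L` active pairs is a multiple of the average of its subvectors
with `L_I` active pairs. As the region is closed, convex and coordinate-convex, it contains the
mean arrival vector.
-/

namespace IASVD

/-! ### Independence -/

section Freezing

variable {Ω α β : Type*} [MeasurableSpace Ω] [MeasurableSpace α] [MeasurableSpace β]
  {μ : Measure Ω} [IsFiniteMeasure μ] {X : Ω → α} {Y : Ω → β}

lemma identDistrib_prodMap_of_indepFun (hX : Measurable X) (hY : Measurable Y)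
    (hXY : IndepFun X Y μ) :
    IdentDistrib (Prod.map X Y) (fun ω => (X ω, Y ω)) (μ.prod μ) μ where
  aemeasurable_fst := (hX.prodMap hY).aemeasurable
  aemeasurable_snd := (hX.prodMk hY).aemeasurable
  map_eq := by
    rw [← Measure.map_prod_map _ _ hX hY, (indepFun_iff_map_prod_eq_prod_map_map
      hX.aemeasurable hY.aemeasurable).1 hXY]

lemma integrable_integral_freeze (hX : Measurable X) (hY : Measurable Y) (hXY : IndepFun X Y μ)
    {h : α × β → ℝ} (hh : Measurable h) (hi : Integrable (fun ω => h (X ω, Y ω)) μ) :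
    Integrable (fun ω => ∫ ω', h (X ω, Y ω') ∂μ) μ :=
  (((identDistrib_prodMap_of_indepFun hX hY hXY).comp hh).integrable_iff.2 hi).integral_prod_left

lemma integral_freeze (hX : Measurable X) (hY : Measurable Y) (hXY : IndepFun X Y μ)
    {h : α × β → ℝ} (hh : Measurable h) (hi : Integrable (fun ω => h (X ω, Y ω)) μ) :
    ∫ ω, ∫ ω', h (X ω, Y ω') ∂μ ∂μ = ∫ ω, h (X ω, Y ω) ∂μ := by
  have hident := (identDistrib_prodMap_of_indepFun hX hY hXY).comp hh
  rw [← show _ = ∫ ω, h (X ω, Y ω) ∂μ from hident.integral_eq,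
    integral_prod _ (hident.integrable_iff.2 hi)]
  rfl

end Freezing

/-! ### Bounded averages -/

/-- The time averages of `u` are eventually bounded: `limsup_T (1/T) ∑_{t<T} u t < ∞`. -/
def HasBoundedAverage (u : ℕ → ℝ) : Prop :=
  ∃ M : ℝ, ∀ᶠ T : ℕ in atTop, ∑ t ∈ Finset.range T, u t ≤ M * T

namespace HasBoundedAverage

lemma mono {u v : ℕ → ℝ} (hv : HasBoundedAverage v) (huv : ∀ t, u t ≤ v t) :
    HasBoundedAverage u :=
  hv.imp fun _ hM => hM.mono fun _ hT => (Finset.sum_le_sum fun t _ => huv t).trans hT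

lemma sum {ι : Type*} {s : Finset ι} {u : ι → ℕ → ℝ} (hu : ∀ i ∈ s, HasBoundedAverage (u i)) :
    HasBoundedAverage fun t => ∑ i ∈ s, u i t := by
  choose! M hM using hu
  refine ⟨∑ i ∈ s, M i, ?_⟩
  filter_upwards [(eventually_all_finset s).2 hM] with T hT
  rw [Finset.sum_comm, Finset.sum_mul]
  exact Finset.sum_le_sum hT

lemma exists_frequently_le {u : ℕ → ℝ} (hu : HasBoundedAverage u) (h0 : ∀ t, 0 ≤ u t) :
    ∃ C, ∃ᶠ T in atTop, u T ≤ C := by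
  obtain ⟨M, hM⟩ := hu
  refine ⟨M + 1, fun hlarge => ?_⟩
  obtain ⟨T₀, hT₀⟩ := eventually_atTop.1 hlarge
  obtain ⟨T, hTM, hTT₀, hTlarge⟩ := (hM.and ((eventually_ge_atTop T₀).and
    (tendsto_natCast_atTop_atTop.eventually_gt_atTop ((M + 1) * T₀)))).exists
  have htail : (T - T₀ : ℝ) * (M + 1) ≤ ∑ t ∈ Finset.Ico T₀ T, u t := by
    rw [← Nat.cast_sub hTT₀, ← Nat.card_Ico, ← nsmul_eq_mul]
    exact Finset.card_nsmul_le_sum _ _ _ fun t ht => (not_le.1 (hT₀ t (Finset.mem_Ico.1 ht).1)).le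
  have hhead : 0 ≤ ∑ t ∈ Finset.range T₀, u t := Finset.sum_nonneg fun t _ => h0 t
  have hsplit := Finset.sum_range_add_sum_Ico u hTT₀
  linarith

lemma of_drift {V u : ℕ → ℝ} {C ε : ℝ} (hε : 0 < ε) (hV : ∀ t, 0 ≤ V t)
    (hdrift : ∀ t, V (t + 1) ≤ V t + C - ε * u t) : HasBoundedAverage u := by
  have htelescope : ∀ T : ℕ, V T + ε * ∑ t ∈ Finset.range T, u t ≤ V 0 + C * T := by
    intro T
    induction T with
    | zero => simp
    | succ T ih =>
      rw [Finset.sum_range_succ]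
      push_cast
      linarith [hdrift T]
  refine ⟨(V 0 + C) / ε, (eventually_ge_atTop 1).mono fun T hT => ?_⟩
  have hT' : (1 : ℝ) ≤ T := by exact_mod_cast hT
  rw [div_mul_eq_mul_div, le_div_iff₀ hε]
  linarith [htelescope T, hV T, mul_le_mul_of_nonneg_left hT' (hV 0)]

end HasBoundedAverage

/-- A set that contains, with `x`, every nonnegative vector below `x`. -/
def IsCoordinateConvex {ι : Type*} (Λ : Set (ι → ℝ)) : Prop :=
  ∀ x ∈ Λ, Set.Icc 0 x ⊆ Λ

/-- Averaging the balance `T a ≤ u T + ∑_{t<T} r t` over times `T` at which `u T` stays bounded. -/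
lemma mem_of_balance {ι : Type*} [Fintype ι] {Λ : Set (ι → ℝ)} (hconv : Convex ℝ Λ)
    (hclosed : IsClosed Λ) (hcoord : IsCoordinateConvex Λ) {a : ι → ℝ} (ha : 0 ≤ a)
    {u r : ℕ → ι → ℝ} (hu : ∀ t, 0 ≤ u t) (hr : ∀ t, r t ∈ Λ)
    (hr0 : ∀ t, 0 ≤ r t) (hstep : ∀ t, u t + a - r t ≤ u (t + 1))
    (hbdd : HasBoundedAverage fun t => ∑ k, u t k) : a ∈ Λ := by
  obtain ⟨C, hC⟩ := hbdd.exists_frequently_le fun t => Finset.sum_nonneg fun k _ => hu t k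
  have hbalance : ∀ (T : ℕ) (k : ι), T * a k ≤ u T k + ∑ t ∈ Finset.range T, r t k := by
    intro T k
    induction T with
    | zero => simpa using hu 0 k
    | succ T ih =>
      have hk := hstep T k
      simp only [Pi.add_apply, Pi.sub_apply] at hk
      rw [Finset.sum_range_succ]
      push_cast
      linarith
  have hmem : ∃ᶠ T : ℕ in atTop, (fun k => max (a k - C / T) 0) ∈ Λ := by
    refine (hC.and_eventually (eventually_ge_atTop 1)).mono fun T ⟨hCT, hT⟩ => ?_
    have hT0 : (0 : ℝ) < T := by exact_mod_cast hT
    have havg : ∑ t ∈ Finset.range T, (T : ℝ)⁻¹ • r t ∈ Λ :=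
      hconv.sum_mem (fun _ _ => by positivity) (by simp [hT0.ne']) fun t _ => hr t
    refine hcoord _ havg ⟨fun k => le_max_right _ _, fun k => ?_⟩
    have huC : u T k ≤ C :=
      (Finset.single_le_sum (fun k _ => hu T k) (Finset.mem_univ k)).trans hCT
    have hrk : 0 ≤ ∑ t ∈ Finset.range T, r t k := Finset.sum_nonneg fun t _ => hr0 t k
    rw [← Finset.smul_sum, Pi.smul_apply, Finset.sum_apply, smul_eq_mul, le_inv_mul_iff₀ hT0,
      mul_max_of_nonneg _ _ hT0.le, mul_sub, mul_div_cancel₀ _ hT0.ne', mul_zero]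
    exact max_le (by linarith [hbalance T k]) hrk
  refine hclosed.mem_of_frequently_of_tendsto hmem (tendsto_pi_nhds.2 fun k => ?_)
  have hlim : Tendsto (fun T : ℕ => max (a k - C / T) 0) atTop (𝓝 (max (a k - 0) 0)) :=
    ((tendsto_const_nhds).sub (tendsto_const_div_atTop_nhds_zero_nat C)).max tendsto_const_nhds
  rwa [sub_zero, max_eq_left (show (0 : ℝ) ≤ a k from ha k)] at hlim

/-! ### Queues served in slots -/

section SlottedQueues

variable {Ω 𝒳 ι : Type*}

/-- One slot of a vector of queues in a slot of state `x`: with queue lengths `q`, queue `k` is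
offered the service `B q x k`, and then receives the arrivals `A x k`. -/
def queueStep (A : 𝒳 → ι → ℝ) (B : (ι → ℝ) → 𝒳 → ι → ℝ) (q : ι → ℝ) (x : 𝒳) : ι → ℝ :=
  fun k => max (q k - B q x k) 0 + A x k

/-- Queue lengths at time `t`, from the initial lengths `q₀` and with the random slot
states `x`. -/
def queueLength (A : 𝒳 → ι → ℝ) (B : (ι → ℝ) → 𝒳 → ι → ℝ) (x : ℕ → Ω → 𝒳) (q₀ : ι → ℝ) :
    ℕ → Ω → ι → ℝ
  | 0, _ => q₀
  | t + 1, ω => queueStep A B (queueLength A B x q₀ t ω) (x t ω)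

lemma queueStep_sq_le {A : 𝒳 → ι → ℝ} {B : (ι → ℝ) → 𝒳 → ι → ℝ} {q : ι → ℝ} {x : 𝒳} {K : ℝ}
    {k : ι} (hq : 0 ≤ q k) (hA : A x k ∈ Set.Icc 0 K) (hB : B q x k ∈ Set.Icc 0 K) :
    queueStep A B q x k ^ 2 ≤ q k ^ 2 + 2 * K ^ 2 + 2 * (q k * (A x k - B q x k)) := by
  have hmax_sq : max (q k - B q x k) 0 ^ 2 ≤ (q k - B q x k) ^ 2 := by
    rcases max_cases (q k - B q x k) 0 with h | h <;> rw [h.1]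
    simpa using sq_nonneg _
  have hmax_le : max (q k - B q x k) 0 ≤ q k := max_le (by linarith [hB.1]) hq
  have hA2 : A x k ^ 2 ≤ K ^ 2 := pow_le_pow_left₀ hA.1 hA.2 2
  have hB2 : B q x k ^ 2 ≤ K ^ 2 := pow_le_pow_left₀ hB.1 hB.2 2
  unfold queueStep
  nlinarith [mul_le_mul_of_nonneg_left hmax_le hA.1]

variable [MeasurableSpace Ω] [MeasurableSpace 𝒳]

/-- Slot states `x t` that are independent over time and drive a vector of queues with arrivals
`A` and state-dependent service `B`, both bounded by `K`: the mean arrivals are `a`, and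
`ρ q` is the mean service offered at queue lengths `q`. -/
structure SlottedQueues (μ : Measure Ω) (x : ℕ → Ω → 𝒳) (A : 𝒳 → ι → ℝ)
    (B : (ι → ℝ) → 𝒳 → ι → ℝ) (a : ι → ℝ) (ρ : (ι → ℝ) → ι → ℝ) (K : ℝ) : Prop where
  measurable_state : ∀ t, Measurable (x t)
  indep : iIndepFun x μ
  measurable_arrival : Measurable A
  measurable_service : Measurable (Function.uncurry B)
  arrival_mem : ∀ᵐ ω ∂μ, ∀ t k, A (x t ω) k ∈ Set.Icc 0 K
  service_mem : ∀ q y k, B q y k ∈ Set.Icc 0 K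
  integral_arrival : ∀ t k, ∫ ω, A (x t ω) k ∂μ = a k
  integral_service : ∀ t q k, ∫ ω, B q (x t ω) k ∂μ = ρ q k

namespace SlottedQueues

variable {μ : Measure Ω} {x : ℕ → Ω → 𝒳} {A : 𝒳 → ι → ℝ} {B : (ι → ℝ) → 𝒳 → ι → ℝ} {a q₀ : ι → ℝ}
  {ρ : (ι → ℝ) → ι → ℝ} {K : ℝ}

lemma measurable_queueStep (h : SlottedQueues μ x A B a ρ K) :
    Measurable fun z : (ι → ℝ) × 𝒳 => queueStep A B z.1 z.2 := by
  refine measurable_pi_lambda _ fun k => ?_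
  have hB : Measurable fun z : (ι → ℝ) × 𝒳 => B z.1 z.2 k :=
    (measurable_pi_apply k).comp h.measurable_service
  have hA := h.measurable_arrival
  unfold queueStep
  fun_prop

lemma measurable_queueLength_past (h : SlottedQueues μ x A B a ρ K) (t : ℕ) :
    Measurable[⨆ s ∈ Set.Iio t, MeasurableSpace.comap (x s) inferInstance]
      (queueLength A B x q₀ t) := by
  induction t with
  | zero => exact @measurable_const _ _ _ (_) q₀
  | succ t ih =>
    have hpast : Measurable[⨆ s ∈ Set.Iio (t + 1), MeasurableSpace.comap (x s) inferInstance]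
        (queueLength A B x q₀ t) :=
      ih.mono (biSup_mono fun s hs => hs.trans t.lt_succ_self) le_rfl
    have hstate : Measurable[⨆ s ∈ Set.Iio (t + 1), MeasurableSpace.comap (x s) inferInstance]
        (x t) :=
      (comap_measurable _).mono
        (le_biSup (fun s => MeasurableSpace.comap (x s) inferInstance) t.lt_succ_self) le_rfl
    exact h.measurable_queueStep.comp (hpast.prodMk hstate)

lemma measurable_queueLength (h : SlottedQueues μ x A B a ρ K) (t : ℕ) :
    Measurable (queueLength A B x q₀ t) :=
  h.measurable_queueLength_past t |>.mono
    (iSup₂_le fun s _ => (h.measurable_state s).comap_le) le_rfl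

lemma indepFun_queueLength (h : SlottedQueues μ x A B a ρ K) (t : ℕ) :
    IndepFun (queueLength A B x q₀ t) (x t) μ := by
  have hpast_present := indep_iSup_of_disjoint (S := Set.Iio t) (T := {t})
    (fun s => (h.measurable_state s).comap_le) h.indep (by simp)
  rw [IndepFun_iff_Indep]
  refine indep_of_indep_of_le_left (indep_of_indep_of_le_right hpast_present ?_)
    (h.measurable_queueLength_past t).comap_le
  exact le_biSup (fun s => MeasurableSpace.comap (x s) inferInstance) (Set.mem_singleton t)

lemma queueLength_mem (h : SlottedQueues μ x A B a ρ K) (hq₀ : 0 ≤ q₀) :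
    ∀ᵐ ω ∂μ, ∀ (t : ℕ) k, queueLength A B x q₀ t ω k ∈ Set.Icc 0 (q₀ k + K * t) := by
  filter_upwards [h.arrival_mem] with ω hA t
  induction t with
  | zero => exact fun k => ⟨hq₀ k, by simp [queueLength]⟩
  | succ t ih =>
    intro k
    have hmax : max (queueLength A B x q₀ t ω k - B (queueLength A B x q₀ t ω) (x t ω) k) 0 ≤
        q₀ k + K * t :=
      max_le (by linarith [(ih k).2, (h.service_mem (queueLength A B x q₀ t ω) (x t ω) k).1])
        ((ih k).1.trans (ih k).2)
    refine ⟨add_nonneg (le_max_right _ _) (hA t k).1, ?_⟩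
    push_cast
    simp only [queueLength, queueStep]
    linarith [(hA t k).2]

lemma queueLength_nonneg (h : SlottedQueues μ x A B a ρ K) (hq₀ : 0 ≤ q₀) (t : ℕ) :
    ∀ᵐ ω ∂μ, 0 ≤ queueLength A B x q₀ t ω :=
  (h.queueLength_mem hq₀).mono fun _ hω k => (hω t k).1

lemma ae_sum_sq_queueStep_le [Fintype ι] (h : SlottedQueues μ x A B a ρ K) (t : ℕ)
    {q : ι → ℝ} (hq : 0 ≤ q) :
    ∀ᵐ ω ∂μ, ∑ k, queueStep A B q (x t ω) k ^ 2 ≤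
      ∑ k, (q k ^ 2 + 2 * K ^ 2 + 2 * (q k * (A (x t ω) k - B q (x t ω) k))) :=
  h.arrival_mem.mono fun ω hA =>
    Finset.sum_le_sum fun k _ => queueStep_sq_le (hq k) (hA t k) (h.service_mem q (x t ω) k)

variable [IsProbabilityMeasure μ]

lemma integrable_queueLength_pow (h : SlottedQueues μ x A B a ρ K) (hq₀ : 0 ≤ q₀) (t : ℕ) (k : ι)
    (n : ℕ) : Integrable (fun ω => queueLength A B x q₀ t ω k ^ n) μ := by
  refine Integrable.of_bound (((measurable_pi_apply k).comp
    (h.measurable_queueLength t)).pow_const n).aestronglyMeasurable ((q₀ k + K * t) ^ n) ?_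
  filter_upwards [h.queueLength_mem hq₀] with ω hω
  rw [norm_pow, Real.norm_of_nonneg (hω t k).1]
  exact pow_le_pow_left₀ (hω t k).1 (hω t k).2 n

lemma integrable_queueLength (h : SlottedQueues μ x A B a ρ K) (hq₀ : 0 ≤ q₀) (t : ℕ) (k : ι) :
    Integrable (fun ω => queueLength A B x q₀ t ω k) μ := by
  simpa using h.integrable_queueLength_pow hq₀ t k 1

lemma integrable_arrival (h : SlottedQueues μ x A B a ρ K) (t : ℕ) (k : ι) :
    Integrable (fun ω => A (x t ω) k) μ :=
  Integrable.of_mem_Icc 0 K ((measurable_pi_apply k).comp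
    (h.measurable_arrival.comp (h.measurable_state t))).aemeasurable
    (h.arrival_mem.mono fun _ hω => hω t k)

lemma integrable_service (h : SlottedQueues μ x A B a ρ K) (t : ℕ) (q : ι → ℝ) (k : ι) :
    Integrable (fun ω => B q (x t ω) k) μ :=
  Integrable.of_mem_Icc 0 K ((measurable_pi_apply k).comp
    (h.measurable_service.comp (measurable_const.prodMk (h.measurable_state t)))).aemeasurable
    (ae_of_all _ fun ω => h.service_mem q (x t ω) k)

lemma meanService_mem (h : SlottedQueues μ x A B a ρ K) (q : ι → ℝ) (k : ι) :
    ρ q k ∈ Set.Icc 0 K := by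
  rw [← h.integral_service 0 q k]
  exact (convex_Icc 0 K).integral_mem isClosed_Icc (ae_of_all _ fun ω => h.service_mem q (x 0 ω) k)
    (h.integrable_service 0 q k)

lemma measurable_meanService (h : SlottedQueues μ x A B a ρ K) (k : ι) :
    Measurable fun q => ρ q k := by
  have hB : Measurable fun z : (ι → ℝ) × Ω => B z.1 (x 0 z.2) k :=
    (measurable_pi_apply k).comp (h.measurable_service.comp
      (measurable_fst.prodMk ((h.measurable_state 0).comp measurable_snd)))
  simp_rw [← h.integral_service 0 _ k]
  exact hB.stronglyMeasurable.integral_prod_right'.measurable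

lemma integrable_meanService (h : SlottedQueues μ x A B a ρ K) (t : ℕ) (k : ι) :
    Integrable (fun ω => ρ (queueLength A B x q₀ t ω) k) μ :=
  Integrable.of_mem_Icc 0 K
    ((h.measurable_meanService k).comp (h.measurable_queueLength t)).aemeasurable
    (ae_of_all _ fun _ => h.meanService_mem _ k)

lemma integrable_queueStep (h : SlottedQueues μ x A B a ρ K) (t : ℕ) (q : ι → ℝ) (k : ι) :
    Integrable (fun ω => queueStep A B q (x t ω) k) μ := by
  exact (((integrable_const _).sub (h.integrable_service t q k)).sup (integrable_const _)).add
    (h.integrable_arrival t k)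

lemma integral_queueStep_ge (h : SlottedQueues μ x A B a ρ K) (t : ℕ) (q : ι → ℝ) (k : ι) :
    q k + a k - ρ q k ≤ ∫ ω, queueStep A B q (x t ω) k ∂μ := by
  have hB := h.integrable_service t q k
  have hA := h.integrable_arrival t k
  have hqB : Integrable (fun ω => q k - B q (x t ω) k) μ := (integrable_const _).sub hB
  calc q k + a k - ρ q k = ∫ ω, (q k - B q (x t ω) k + A (x t ω) k) ∂μ := by
        rw [integral_add hqB hA, integral_sub (integrable_const _) hB,
          h.integral_service, h.integral_arrival]
        simp only [integral_const, probReal_univ, one_smul]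
        ring
    _ ≤ ∫ ω, queueStep A B q (x t ω) k ∂μ :=
        integral_mono (hqB.add hA) (h.integrable_queueStep t q k)
          fun ω => add_le_add_left (le_max_left _ _) _

lemma integral_queueLength_succ_ge (h : SlottedQueues μ x A B a ρ K) (hq₀ : 0 ≤ q₀) (t : ℕ)
    (k : ι) :
    ∫ ω, queueLength A B x q₀ t ω k ∂μ + a k - ∫ ω, ρ (queueLength A B x q₀ t ω) k ∂μ ≤
      ∫ ω, queueLength A B x q₀ (t + 1) ω k ∂μ := by
  have hq := h.integrable_queueLength hq₀ t k
  have hρ := h.integrable_meanService (q₀ := q₀) t k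
  have hqa : Integrable (fun ω => queueLength A B x q₀ t ω k + a k) μ :=
    hq.add (integrable_const _)
  have hX := h.measurable_queueLength (q₀ := q₀) t
  have hY := h.measurable_state t
  have hstep := (measurable_pi_apply k).comp h.measurable_queueStep
  have hnext := h.integrable_queueLength hq₀ (t + 1) k
  calc _ = ∫ ω, (queueLength A B x q₀ t ω k + a k - ρ (queueLength A B x q₀ t ω) k) ∂μ := by
        rw [integral_sub hqa hρ, integral_add hq (integrable_const _)]
        simp only [integral_const, probReal_univ, one_smul]
    _ ≤ ∫ ω, ∫ ω', queueStep A B (queueLength A B x q₀ t ω) (x t ω') k ∂μ ∂μ :=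
        integral_mono (hqa.sub hρ)
          (integrable_integral_freeze hX hY (h.indepFun_queueLength t) hstep hnext)
          fun ω => h.integral_queueStep_ge t _ k
    _ = ∫ ω, queueLength A B x q₀ (t + 1) ω k ∂μ :=
        integral_freeze hX hY (h.indepFun_queueLength t) hstep hnext

variable [Fintype ι]

lemma integral_sum_sq_queueStep_le (h : SlottedQueues μ x A B a ρ K) (t : ℕ) {q : ι → ℝ}
    (hq : 0 ≤ q) :
    ∫ ω, ∑ k, queueStep A B q (x t ω) k ^ 2 ∂μ ≤
      ∑ k, (q k ^ 2 + 2 * K ^ 2 + 2 * (q k * (a k - ρ q k))) := by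
  have hAB : ∀ k, Integrable (fun ω => A (x t ω) k - B q (x t ω) k) μ :=
    fun k => (h.integrable_arrival t k).sub (h.integrable_service t q k)
  have hterm : ∀ k ∈ Finset.univ, Integrable
      (fun ω => q k ^ 2 + 2 * K ^ 2 + 2 * (q k * (A (x t ω) k - B q (x t ω) k))) μ :=
    fun k _ => (integrable_const _).add (((hAB k).const_mul _).const_mul _)
  calc _ ≤ ∫ ω, ∑ k, (q k ^ 2 + 2 * K ^ 2 + 2 * (q k * (A (x t ω) k - B q (x t ω) k))) ∂μ :=
        integral_mono_of_nonneg (ae_of_all _ fun ω => Finset.sum_nonneg fun k _ => sq_nonneg _)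
          (integrable_finsetSum _ hterm) (h.ae_sum_sq_queueStep_le t hq)
    _ = ∑ k, (q k ^ 2 + 2 * K ^ 2 + 2 * (q k * (a k - ρ q k))) := by
        rw [integral_finsetSum _ hterm]
        refine Finset.sum_congr rfl fun k _ => ?_
        rw [integral_add (integrable_const _) (((hAB k).const_mul _).const_mul _),
          integral_const_mul, integral_const_mul,
          integral_sub (h.integrable_arrival t k) (h.integrable_service t q k),
          h.integral_arrival, h.integral_service, integral_const, probReal_univ, one_smul]

lemma integral_sum_sq_queueLength_succ_le (h : SlottedQueues μ x A B a ρ K) (hq₀ : 0 ≤ q₀) {ε : ℝ}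
    (hρ : ∀ q, 0 ≤ q → ∑ k, q k * (a k + ε) ≤ ∑ k, q k * ρ q k) (t : ℕ) :
    ∫ ω, ∑ k, queueLength A B x q₀ (t + 1) ω k ^ 2 ∂μ ≤
      ∫ ω, ∑ k, queueLength A B x q₀ t ω k ^ 2 ∂μ + Fintype.card ι * (2 * K ^ 2) -
        2 * ε * ∫ ω, ∑ k, queueLength A B x q₀ t ω k ∂μ := by
  have hsq := fun t => integrable_finsetSum Finset.univ
    fun k _ => h.integrable_queueLength_pow hq₀ t k 2
  have hsqC : Integrable
      (fun ω => ∑ k, queueLength A B x q₀ t ω k ^ 2 + Fintype.card ι * (2 * K ^ 2)) μ :=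
    (hsq t).add (integrable_const _)
  have hq := integrable_finsetSum Finset.univ fun k _ => h.integrable_queueLength hq₀ t k
  have hX := h.measurable_queueLength (q₀ := q₀) t
  have hY := h.measurable_state t
  have hstep : Measurable fun z : (ι → ℝ) × 𝒳 => ∑ k, queueStep A B z.1 z.2 k ^ 2 :=
    Finset.measurable_fun_sum _ fun k _ =>
      ((measurable_pi_apply k).comp h.measurable_queueStep).pow_const 2
  have hdrift : ∀ q, 0 ≤ q → ∫ ω, ∑ k, queueStep A B q (x t ω) k ^ 2 ∂μ ≤
      ∑ k, q k ^ 2 + Fintype.card ι * (2 * K ^ 2) - 2 * ε * ∑ k, q k := fun q hq => by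
    have hsum := h.integral_sum_sq_queueStep_le t hq
    have hgap := hρ q hq
    simp only [mul_sub, mul_add, Finset.sum_add_distrib, Finset.sum_sub_distrib, ← Finset.mul_sum,
      ← Finset.sum_mul, Finset.sum_const, Finset.card_univ, nsmul_eq_mul] at hsum hgap
    linarith
  calc _ = ∫ ω, ∫ ω', ∑ k, queueStep A B (queueLength A B x q₀ t ω) (x t ω') k ^ 2 ∂μ ∂μ :=
        (integral_freeze hX hY (h.indepFun_queueLength t) hstep (hsq (t + 1))).symm
    _ ≤ ∫ ω, (∑ k, queueLength A B x q₀ t ω k ^ 2 + Fintype.card ι * (2 * K ^ 2) -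
          2 * ε * ∑ k, queueLength A B x q₀ t ω k) ∂μ :=
        integral_mono_ae
          (integrable_integral_freeze hX hY (h.indepFun_queueLength t) hstep (hsq (t + 1)))
          (hsqC.sub (hq.const_mul _))
          ((h.queueLength_nonneg hq₀ t).mono fun ω hω => hdrift _ hω)
    _ = _ := by
        rw [integral_sub hsqC (hq.const_mul _),
          integral_add (hsq t) (integrable_const _), integral_const,
          probReal_univ, one_smul, integral_const_mul]

/-- Foster-Lyapunov criterion with the Lyapunov function `∑ₖ qₖ²`. -/
theorem hasBoundedAverage_of_gap (h : SlottedQueues μ x A B a ρ K) (hq₀ : 0 ≤ q₀) {ε : ℝ}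
    (hε : 0 < ε) (hρ : ∀ q, 0 ≤ q → ∑ k, q k * (a k + ε) ≤ ∑ k, q k * ρ q k) (k : ι) :
    HasBoundedAverage fun t => ∫ ω, queueLength A B x q₀ t ω k ∂μ := by
  have hsum : HasBoundedAverage fun t => ∫ ω, ∑ k, queueLength A B x q₀ t ω k ∂μ :=
    .of_drift (V := fun t => ∫ ω, ∑ k, queueLength A B x q₀ t ω k ^ 2 ∂μ)
      (mul_pos two_pos hε) (fun t => integral_nonneg fun ω => Finset.sum_nonneg fun k _ =>
        sq_nonneg _) fun t => h.integral_sum_sq_queueLength_succ_le hq₀ hρ t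
  refine hsum.mono fun t => integral_mono_ae (h.integrable_queueLength hq₀ t k)
    (integrable_finsetSum _ fun k _ => h.integrable_queueLength hq₀ t k) ?_
  exact (h.queueLength_nonneg hq₀ t).mono fun ω hω =>
    Finset.single_le_sum (fun k _ => hω k) (Finset.mem_univ k)

omit [Fintype ι] in
theorem mem_of_hasBoundedAverage [Finite ι] (h : SlottedQueues μ x A B a ρ K) (hq₀ : 0 ≤ q₀)
    {Λ : Set (ι → ℝ)} (hconv : Convex ℝ Λ) (hclosed : IsClosed Λ) (hcoord : IsCoordinateConvex Λ)
    (hρ : ∀ q, ρ q ∈ Λ)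
    (hbdd : ∀ k, HasBoundedAverage fun t => ∫ ω, queueLength A B x q₀ t ω k ∂μ) : a ∈ Λ := by
  have := Fintype.ofFinite ι
  have ha : 0 ≤ a := fun k => by
    rw [← h.integral_arrival 0 k]
    exact integral_nonneg_of_ae (h.arrival_mem.mono fun ω hω => (hω 0 k).1)
  have hmeanρ : ∀ t, (fun k => ∫ ω, ρ (queueLength A B x q₀ t ω) k ∂μ) ∈ Λ := fun t => by
    have hint : Integrable (fun ω => ρ (queueLength A B x q₀ t ω)) μ :=
      Integrable.of_eval fun k => h.integrable_meanService t k
    rw [← funext (eval_integral fun k => h.integrable_meanService (q₀ := q₀) t k)]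
    exact hconv.integral_mem hclosed (ae_of_all μ fun ω => hρ _) hint
  exact mem_of_balance hconv hclosed hcoord ha
    (u := fun t k => ∫ ω, queueLength A B x q₀ t ω k ∂μ)
    (fun t k => integral_nonneg_of_ae ((h.queueLength_nonneg hq₀ t).mono fun ω hω => hω k))
    hmeanρ (fun t k => integral_nonneg fun ω => (h.meanService_mem _ k).1)
    (fun t k => h.integral_queueLength_succ_ge hq₀ t k) (.sum fun k _ => hbdd k)

end SlottedQueues

end SlottedQueues
/-! ### Exponential, Gamma and Beta distributions -/

section Distributions

lemma integral_mem_Ioo_of_ae_mem_Ioo {α : Type*} [MeasurableSpace α] {ν : Measure α}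
    [IsProbabilityMeasure ν] {f : α → ℝ} (hf : AEStronglyMeasurable f ν)
    (h : ∀ᵐ x ∂ν, f x ∈ Set.Ioo 0 1) : ∫ x, f x ∂ν ∈ Set.Ioo 0 1 := by
  have integral_pos {g : α → ℝ} (hg : Integrable g ν) (hpos : ∀ᵐ x ∂ν, 0 < g x) :
      0 < ∫ x, g x ∂ν := by
    rw [integral_pos_iff_support_of_nonneg_ae (hpos.mono fun x hx => hx.le) hg]
    have hsupport : (Function.support g : Set α) =ᵐ[ν] Set.univ :=
      eventuallyEq_univ.2 (hpos.mono fun x hx => hx.ne')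
    simp [measure_congr hsupport]
  have hfi : Integrable f ν := Integrable.of_bound hf 1 <| h.mono fun x hx => by
    rw [Real.norm_eq_abs, abs_of_pos hx.1]; exact hx.2.le
  refine ⟨integral_pos hfi (h.mono fun x hx => hx.1), ?_⟩
  have hgap := integral_pos ((integrable_const 1).sub hfi) (h.mono fun x hx => sub_pos.2 hx.2)
  simp only [Pi.sub_apply] at hgap
  rwa [integral_sub (integrable_const _) hfi, integral_const, probReal_univ, one_smul,
    sub_pos] at hgap

lemma expMeasure_real_Ici {r x : ℝ} (hr : 0 < r) (hx : 0 ≤ x) :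
    (expMeasure r).real (Set.Ici x) = Real.exp (-(r * x)) := by
  have : IsProbabilityMeasure (expMeasure r) := isProbabilityMeasure_expMeasure hr
  have : NullSingletonClass (expMeasure r) := by
    unfold expMeasure gammaMeasure; infer_instance
  rw [← Set.compl_Iio, probReal_compl_eq_one_sub measurableSet_Iio,
    measureReal_congr Iio_ae_eq_Iic, ← cdf_eq_real, cdf_expMeasure_eq hr, if_pos hx,
    sub_sub_cancel]

lemma ae_gammaMeasure_nonneg (a r : ℝ) : ∀ᵐ x ∂gammaMeasure a r, 0 ≤ x := by
  rw [gammaMeasure, ae_withDensity_iff (by unfold gammaPDF; fun_prop)]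
  exact .of_forall fun x hx => not_lt.1 fun h => hx (gammaPDF_of_neg h)

lemma ae_betaMeasure_mem_Ioo (a b : ℝ) : ∀ᵐ x ∂betaMeasure a b, x ∈ Set.Ioo 0 1 := by
  rw [betaMeasure, ae_withDensity_iff (by unfold betaPDF; fun_prop)]
  exact .of_forall fun x hx => ⟨not_le.1 fun h => hx (betaPDF_eq_zero_of_nonpos h),
    not_le.1 fun h => hx (betaPDF_eq_zero_of_one_le h)⟩

lemma integral_gammaMeasure {a r : ℝ} (ha : 0 < a) (hr : 0 < r) (g : ℝ → ℝ) :
    ∫ x, g x ∂gammaMeasure a r = ∫ x, gammaPDFReal a r x * g x := by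
  rw [gammaMeasure, integral_withDensity_eq_integral_toReal_smul (by unfold gammaPDF; fun_prop)
    (by simp [gammaPDF])]
  simp only [gammaPDF, ENNReal.toReal_ofReal (gammaPDFReal_nonneg ha hr _), smul_eq_mul]

lemma betaPDFReal_nonneg {a b : ℝ} (ha : 0 < a) (hb : 0 < b) (x : ℝ) : 0 ≤ betaPDFReal a b x := by
  by_cases h : 0 < x ∧ x < 1
  · exact (betaPDFReal_pos h.1 h.2 ha hb).le
  · simp [betaPDFReal, h]

lemma integral_betaMeasure {a b : ℝ} (ha : 0 < a) (hb : 0 < b) (g : ℝ → ℝ) :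
    ∫ x, g x ∂betaMeasure a b = ∫ x, betaPDFReal a b x * g x := by
  rw [betaMeasure, integral_withDensity_eq_integral_toReal_smul (by unfold betaPDF; fun_prop)
    (by simp [betaPDF])]
  simp only [betaPDF, ENNReal.toReal_ofReal (betaPDFReal_nonneg ha hb _), smul_eq_mul]

lemma integral_gammaPDFReal {a r : ℝ} (ha : 0 < a) (hr : 0 < r) :
    ∫ x, gammaPDFReal a r x = 1 := by
  have := isProbabilityMeasure_gammaMeasure ha hr
  simpa using (integral_gammaMeasure ha hr fun _ => 1).symm

lemma integral_betaPDFReal {a b : ℝ} (ha : 0 < a) (hb : 0 < b) :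
    ∫ x, betaPDFReal a b x = 1 := by
  have := isProbabilityMeasureBeta ha hb
  simpa using (integral_betaMeasure ha hb fun _ => 1).symm

lemma gammaPDFReal_mul_exp_neg {a r c : ℝ} (hr : 0 < r) (hrc : 0 < r + c) (x : ℝ) :
    gammaPDFReal a r x * Real.exp (-(c * x)) =
      (r / (r + c)) ^ a * gammaPDFReal a (r + c) x := by
  unfold gammaPDFReal
  split_ifs
  · rw [Real.div_rpow hr.le hrc.le, show -((r + c) * x) = -(r * x) + -(c * x) by ring,
      Real.exp_add]
    have := (Real.rpow_pos_of_pos hrc a).ne'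
    field_simp
  · simp only [zero_mul, mul_zero]

lemma integral_exp_neg_gammaMeasure {a r c : ℝ} (ha : 0 < a) (hr : 0 < r) (hrc : 0 < r + c) :
    ∫ x, Real.exp (-(c * x)) ∂gammaMeasure a r = (r / (r + c)) ^ a := by
  simp_rw [integral_gammaMeasure ha hr, gammaPDFReal_mul_exp_neg hr hrc]
  rw [integral_const_mul, integral_gammaPDFReal ha hrc, mul_one]

lemma integral_one_sub_betaMeasure {a b : ℝ} (ha : 0 < a) (hb : 0 < b) (g : ℝ → ℝ) :
    ∫ y, g (1 - y) ∂betaMeasure a b = ∫ y, g y ∂betaMeasure b a := by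
  have hreflect (y : ℝ) : betaPDFReal a b (1 - y) = betaPDFReal b a y := by
    simp only [betaPDFReal, beta, sub_sub_cancel, sub_pos, sub_lt_self_iff, and_comm, add_comm b a,
      mul_comm (Real.Gamma b)]
    split_ifs <;> ring
  rw [integral_betaMeasure ha hb, integral_betaMeasure hb ha,
    ← integral_sub_left_eq_self _ volume 1]
  simp only [hreflect, sub_sub_cancel]

lemma gamma_add_natCast_eq_ascPochhammer_mul {b : ℝ} (hb : 0 < b) (n : ℕ) :
    Real.Gamma (b + n) = (ascPochhammer ℝ n).eval b * Real.Gamma b := by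
  induction n with
  | zero => simp
  | succ n ih =>
    rw [Nat.cast_succ, ← add_assoc, Real.Gamma_add_one (by positivity), ih,
      ascPochhammer_succ_eval]
    ring

lemma betaPDFReal_mul_pow {a b : ℝ} (ha : 0 < a) (hb : 0 < b) (n : ℕ) (x : ℝ) :
    betaPDFReal a b x * x ^ n = beta (a + n) b / beta a b * betaPDFReal (a + n) b x := by
  unfold betaPDFReal
  split_ifs with h
  · rw [show a + n - 1 = (a - 1) + n by ring, Real.rpow_add h.1, Real.rpow_natCast]
    have := (beta_pos ha hb).ne'
    have := (beta_pos (add_pos_of_pos_of_nonneg ha n.cast_nonneg) hb).ne'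
    field_simp
  · simp only [zero_mul, mul_zero]

lemma integral_pow_betaMeasure {a b : ℝ} (ha : 0 < a) (hb : 0 < b) (n : ℕ) :
    ∫ y, y ^ n ∂betaMeasure a b =
      (ascPochhammer ℝ n).eval a * ((ascPochhammer ℝ n).eval (a + b))⁻¹ := by
  simp_rw [integral_betaMeasure ha hb, betaPDFReal_mul_pow ha hb]
  rw [integral_const_mul, integral_betaPDFReal (by positivity) hb, mul_one, beta, beta,
    add_right_comm, gamma_add_natCast_eq_ascPochhammer_mul ha,
    gamma_add_natCast_eq_ascPochhammer_mul (add_pos ha hb)]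
  have := (Real.Gamma_pos_of_pos ha).ne'
  have := (Real.Gamma_pos_of_pos hb).ne'
  have := (Real.Gamma_pos_of_pos (add_pos ha hb)).ne'
  field_simp

lemma hasSum_ascPochhammer_mul_pow (c : ℝ) {x : ℝ} (hx : |x| < 1) :
    HasSum (fun n : ℕ => (n.factorial : ℝ)⁻¹ * (ascPochhammer ℝ n).eval c * x ^ n)
      ((1 - x) ^ (-c)) := by
  have hcoeff (n : ℕ) :
      Ring.choose (c + n - 1) n = (n.factorial : ℝ)⁻¹ * (ascPochhammer ℝ n).eval c := by
    rw [← Ring.multichoose_eq, eq_inv_mul_iff_mul_eq₀ (by positivity), ← nsmul_eq_mul,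
      Ring.factorial_nsmul_multichoose_eq_ascPochhammer, Polynomial.ascPochhammer_smeval_eq_eval]
  have hsum := (Real.one_div_one_sub_rpow_hasFPowerSeriesOnBall_zero c).hasSum (y := x)
    (by simpa [enorm_eq_nnnorm] using! hx)
  simpa [hcoeff, Real.rpow_neg (sub_nonneg.2 (lt_of_abs_lt hx).le), mul_comm] using hsum

/-- **Euler's integral representation** of the hypergeometric function. -/
lemma integral_one_sub_mul_rpow_betaMeasure {a b x : ℝ} (ha : 0 < a) (hb : 0 < b) (c : ℝ)
    (hx : |x| < 1) :
    ∫ y, (1 - x * y) ^ (-c) ∂betaMeasure a b = ordinaryHypergeometric a c (a + b) x := by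
  have := isProbabilityMeasureBeta ha hb
  have hxy : ∀ᵐ y ∂betaMeasure a b, |x * y| ≤ |x| :=
    (ae_betaMeasure_mem_Ioo a b).mono fun y hy => by
      rw [abs_mul, abs_of_pos hy.1]
      exact mul_le_of_le_one_right (abs_nonneg x) hy.2.le
  have hsum : HasSum
      (fun n : ℕ => ∫ y, (n.factorial : ℝ)⁻¹ * (ascPochhammer ℝ n).eval c * (x * y) ^ n
        ∂betaMeasure a b) (∫ y, (1 - x * y) ^ (-c) ∂betaMeasure a b) := by
    refine hasSum_integral_of_dominated_convergence
      (fun n _ => ‖(n.factorial : ℝ)⁻¹ * (ascPochhammer ℝ n).eval c * x ^ n‖)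
      (fun n => by fun_prop) (fun n => hxy.mono fun y hy => ?_)
      (.of_forall fun _ => (hasSum_ascPochhammer_mul_pow c hx).summable.norm)
      (integrable_const _)
      (hxy.mono fun y hy => hasSum_ascPochhammer_mul_pow c (hy.trans_lt hx))
    simp only [norm_mul _ (_ ^ n), norm_pow, Real.norm_eq_abs (x * y), Real.norm_eq_abs x]
    gcongr
  rw [← hsum.tsum_eq, ordinaryHypergeometric_eq_tsum]
  refine tsum_congr fun n => ?_
  simp_rw [mul_pow, ← mul_assoc]
  rw [integral_const_mul, integral_pow_betaMeasure ha hb, smul_eq_mul]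
  ring

/-- This is Pfaff's transformation: `1 + z y` is `z + 1` times `1 - z / (z + 1) * (1 - y)`. -/
lemma integral_one_add_mul_rpow_betaMeasure {a b z : ℝ} (ha : 0 < a) (hb : 0 < b) (c : ℝ)
    (hz : 0 < z) :
    ∫ y, (1 + z * y) ^ (-c) ∂betaMeasure a b =
      (z + 1) ^ (-c) * ordinaryHypergeometric b c (a + b) (z / (z + 1)) := by
  have hw0 : 0 < z / (z + 1) := by positivity
  have hw1 : z / (z + 1) < 1 := (div_lt_one (by positivity)).2 (by linarith)
  rw [add_comm a b,
    ← integral_one_sub_mul_rpow_betaMeasure hb ha c (by rwa [abs_of_pos hw0]),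
    ← integral_one_sub_betaMeasure ha hb fun y => (1 - z / (z + 1) * y) ^ (-c),
    ← integral_const_mul]
  refine integral_congr_ae ((ae_betaMeasure_mem_Ioo a b).mono fun y hy => ?_)
  simp only
  rw [← Real.mul_rpow (by positivity) (by nlinarith [hy.1, hy.2])]
  congr 1
  field_simp
  ring

end Distributions

/-! ### Coverage probabilities -/

section ExponentialTail

variable {β : Type*} [MeasurableSpace β] (ν : Measure β) [IsProbabilityMeasure ν]

lemma expMeasure_prod_real_le {φ : β → ℝ} (hφ : Measurable φ) (hφ₀ : ∀ᵐ v ∂ν, 0 ≤ φ v) {r : ℝ}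
    (hr : 0 < r) :
    ((expMeasure r).prod ν).real {x | φ x.2 ≤ x.1} = ∫ v, Real.exp (-(r * φ v)) ∂ν := by
  have : IsProbabilityMeasure (expMeasure r) := isProbabilityMeasure_expMeasure hr
  have hS : MeasurableSet {x : ℝ × β | φ x.2 ≤ x.1} :=
    measurableSet_le (hφ.comp measurable_snd) measurable_fst
  rw [← integral_indicator_one hS,
    integral_prod_symm _ (by exact (integrable_const (1 : ℝ)).indicator hS)]
  refine integral_congr_ae (hφ₀.mono fun v hv => ?_)
  simp only
  rw [← expMeasure_real_Ici hr hv, ← integral_indicator_one measurableSet_Ici]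
  rfl

lemma expMeasure_prod_pi_real_add_sum_le {ι : Type*} [Fintype ι] {ψ : β → ℝ} (hψ : Measurable ψ)
    (hψ₀ : ∀ᵐ v ∂ν, 0 ≤ ψ v) {r c : ℝ} (hr : 0 < r) (hc : 0 ≤ c) :
    ((expMeasure r).prod (Measure.pi fun _ : ι => ν)).real {x | c + ∑ i, ψ (x.2 i) ≤ x.1} =
      Real.exp (-(r * c)) * (∫ v, Real.exp (-(r * ψ v)) ∂ν) ^ Fintype.card ι := by
  have hcoord : ∀ᵐ v ∂(Measure.pi fun _ : ι => ν), ∀ i, 0 ≤ ψ (v i) :=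
    ae_all_iff.2 fun i =>
      (Measure.tendsto_eval_ae_ae (μ := fun _ : ι => ν) (i := i)).eventually hψ₀
  have hsum : ∀ᵐ v ∂(Measure.pi fun _ : ι => ν), 0 ≤ c + ∑ i, ψ (v i) :=
    hcoord.mono fun v hv => add_nonneg hc (Finset.sum_nonneg fun i _ => hv i)
  rw [expMeasure_prod_real_le (φ := fun v : ι → β => c + ∑ i, ψ (v i)) _ (by fun_prop) hsum hr]
  simp_rw [mul_add, Finset.mul_sum, neg_add, ← Finset.sum_neg_distrib, Real.exp_add, Real.exp_sum]
  rw [integral_const_mul, integral_fintype_prod_eq_pow fun v => Real.exp (-(r * ψ v))]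

end ExponentialTail

lemma integral_mul_sum_ite {Ω ι : Type*} [MeasurableSpace Ω] {μ : Measure Ω} [IsFiniteMeasure μ]
    [Fintype ι] {f : ι → Ω → Prop} [∀ m ω, Decidable (f m ω)]
    (hf : ∀ m, MeasurableSet {ω | f m ω}) {P : ℝ} (hP : ∀ m, μ.real {ω | f m ω} = P) (x R : ℝ) :
    ∫ ω, x * ∑ m, (if f m ω then R else 0) ∂μ = x * Fintype.card ι * R * P := by
  have hindicator (m : ι) :
      (fun ω => if f m ω then R else 0) = {ω | f m ω}.indicator fun _ => R := by
    ext ω; simp only [Set.indicator_apply, Set.mem_ofPred_eq]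
  rw [integral_const_mul, integral_finsetSum _ fun m _ => by
    rw [hindicator]; exact (integrable_const _).indicator (hf m)]
  simp_rw [hindicator, integral_indicator_const _ (hf _), hP]
  rw [Finset.sum_const, Finset.card_univ, nsmul_eq_mul, smul_eq_mul]
  ring

lemma sq_sum_mul_pow {A : Type*} [CommSemiring A] {n : ℕ} {f : ℕ → A} (hf : ∀ l, n < l → f l = 0)
    (x : A) :
    (∑ l ∈ Finset.range (n + 1), f l * x ^ l) ^ 2 =
      ∑ j ∈ Finset.range (2 * n + 1), (∑ i ∈ Finset.range (j + 1), f i * f (j - i)) * x ^ j := by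
  let P : Polynomial A := ∑ l ∈ Finset.range (n + 1), Polynomial.monomial l (f l)
  have hdeg : P.natDegree ≤ n :=
    Polynomial.natDegree_sum_le_of_forall_le _ _ fun l hl =>
      (Polynomial.natDegree_monomial_le _).trans (Nat.lt_succ_iff.1 (Finset.mem_range.1 hl))
  have hcoeff (l : ℕ) : P.coeff l = f l := by
    simp only [P, Polynomial.finsetSum_coeff, Polynomial.coeff_monomial, Finset.sum_ite_eq']
    split_ifs with h
    · rfl
    · exact (hf l (by simpa using h)).symm
  have heval : P.eval x = ∑ l ∈ Finset.range (n + 1), f l * x ^ l := by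
    simp only [P, Polynomial.eval_finsetSum, Polynomial.eval_monomial]
  have hdeg_sq : (P * P).natDegree < 2 * n + 1 := by
    have := Polynomial.natDegree_mul_le (p := P) (q := P)
    omega
  rw [← heval, ← Polynomial.eval_pow, sq, Polynomial.eval_eq_sum_range' hdeg_sq]
  simp only [Polynomial.coeff_mul, Finset.Nat.sum_antidiagonal_eq_sum_range_succ_mk, hcoeff]

lemma integrableOn_rpow_mul_exp_neg {s x : ℝ} (hs : 0 < s) (hx : 0 ≤ x) :
    IntegrableOn (fun t : ℝ => t ^ (s - 1) * Real.exp (-t)) (Set.Ioi x) :=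
  ((Real.GammaIntegral_convergent hs).mono_set (Set.Ioi_subset_Ioi hx)).congr
    (.of_forall fun _ => mul_comm _ _)

namespace Params

variable {p : Params}

lemma δ_pos : 0 < p.δ := Real.rpow_pos_of_pos two_pos _

lemma two_le_Q (h : 3 ≤ p.Nt * p.Nr) : 2 ≤ p.Q := by unfold Q; omega

lemma Valid.d_pos (hp : p.Valid) : (0 : ℝ) < p.d := by exact_mod_cast hp.one_le_d

lemma Valid.α_pos (hp : p.Valid) : 0 < p.α :=
  div_pos (mul_pos hp.P_pos hp.ζ_pos) hp.d_pos

lemma Valid.Nt_pos (hp : p.Valid) : 0 < p.Nt :=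
  hp.one_le_d.trans (hp.d_le.trans (min_le_left _ _))

lemma Valid.aBeta_pos (hp : p.Valid) (h : 3 ≤ p.Nt * p.Nr) : 0 < p.aBeta := by
  have hQ : (2 : ℝ) ≤ p.Q := by exact_mod_cast two_le_Q h
  have hd : (1 : ℝ) ≤ p.d := by exact_mod_cast hp.one_le_d
  rw [aBeta, ← sub_div]
  exact div_pos (by nlinarith) (by linarith)

lemma Valid.bBeta_pos (hp : p.Valid) (h : 3 ≤ p.Nt * p.Nr) : 0 < p.bBeta := by
  have hQ : (2 : ℝ) ≤ p.Q := by exact_mod_cast two_le_Q h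
  exact mul_pos (by linarith) (hp.aBeta_pos h)

/-- Law of the pair `(X, Y)` attached to an interfering pair: `X ~ Gamma(Q, 2^{B/Q})` and
`Y ~ Beta(ă, b̆)` are independent. -/
noncomputable def interferenceLaw (p : Params) : Measure (ℝ × ℝ) :=
  (gammaMeasure (p.Q : ℝ) p.δ).prod (betaMeasure p.aBeta p.bBeta)

lemma Valid.isProbabilityMeasure_interferenceLaw (hp : p.Valid) (h : 3 ≤ p.Nt * p.Nr) :
    IsProbabilityMeasure p.interferenceLaw := by
  have hQ : (0 : ℝ) < p.Q := by exact_mod_cast two_pos.trans_le (two_le_Q h)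
  have := isProbabilityMeasureBeta (hp.aBeta_pos h) (hp.bBeta_pos h)
  have := isProbabilityMeasure_gammaMeasure hQ (δ_pos (p := p))
  unfold interferenceLaw
  infer_instance

lemma Valid.ae_interferenceLaw_mul_nonneg (hp : p.Valid) (h : 3 ≤ p.Nt * p.Nr) :
    ∀ᵐ x ∂p.interferenceLaw, 0 ≤ x.1 * x.2 := by
  have := isProbabilityMeasureBeta (hp.aBeta_pos h) (hp.bBeta_pos h)
  filter_upwards [Measure.quasiMeasurePreserving_fst.ae (ae_gammaMeasure_nonneg (p.Q : ℝ) p.δ),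
    Measure.quasiMeasurePreserving_snd.ae (ae_betaMeasure_mem_Ioo p.aBeta p.bBeta)] with x hx hy
  exact mul_nonneg hx hy.1.le

lemma Valid.F_eq_integral_betaMeasure (hp : p.Valid) (h : 3 ≤ p.Nt * p.Nr) :
    p.F = ∫ y, (1 + p.d * p.τ / p.δ * y) ^ (-(p.Q : ℝ)) ∂betaMeasure p.aBeta p.bBeta := by
  have hd := hp.d_pos
  have hτ := hp.τ_pos
  have hδ := δ_pos (p := p)
  have hz : 0 < p.d * p.τ / p.δ := by positivity
  have harg : 1 / (p.δ / (p.d * p.τ) + 1) = p.d * p.τ / p.δ / (p.d * p.τ / p.δ + 1) := by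
    field_simp
    ring
  rw [integral_one_add_mul_rpow_betaMeasure (hp.aBeta_pos h) (hp.bBeta_pos h) _ hz, F, harg,
    Real.rpow_neg (by positivity), Real.rpow_natCast]

lemma Valid.integral_exp_neg_interferenceLaw (hp : p.Valid) (h : 3 ≤ p.Nt * p.Nr) :
    ∫ x, Real.exp (-(p.τ * p.d * (x.1 * x.2))) ∂p.interferenceLaw = p.F := by
  have hd := hp.d_pos
  have hτ := hp.τ_pos
  have hδ := δ_pos (p := p)
  have hQ : (0 : ℝ) < p.Q := by exact_mod_cast two_pos.trans_le (two_le_Q h)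
  have := isProbabilityMeasureBeta (hp.aBeta_pos h) (hp.bBeta_pos h)
  have := isProbabilityMeasure_gammaMeasure hQ hδ
  have := hp.isProbabilityMeasure_interferenceLaw h
  have hint : Integrable (fun x => Real.exp (-(p.τ * p.d * (x.1 * x.2)))) p.interferenceLaw := by
    refine Integrable.of_bound (by fun_prop) 1
      ((hp.ae_interferenceLaw_mul_nonneg h).mono fun x hx => ?_)
    rw [Real.norm_eq_abs, Real.abs_exp, Real.exp_le_one_iff, neg_nonpos]
    exact mul_nonneg (by positivity) hx
  rw [interferenceLaw, integral_prod_symm _ hint, hp.F_eq_integral_betaMeasure h]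
  refine integral_congr_ae ((ae_betaMeasure_mem_Ioo _ _).mono fun y hy => ?_)
  have hc : 0 ≤ p.τ * p.d * y := mul_nonneg (by positivity) hy.1.le
  calc ∫ x, Real.exp (-(p.τ * p.d * (x * y))) ∂gammaMeasure (p.Q : ℝ) p.δ
      = ∫ x, Real.exp (-(p.τ * p.d * y * x)) ∂gammaMeasure (p.Q : ℝ) p.δ := by
        simp only [mul_assoc, mul_comm y]
    _ = (p.δ / (p.δ + p.τ * p.d * y)) ^ (p.Q : ℝ) :=
        integral_exp_neg_gammaMeasure hQ hδ (by linarith)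
    _ = (1 + p.d * p.τ / p.δ * y) ^ (-(p.Q : ℝ)) := by
        rw [Real.rpow_neg (by have := hy.1; positivity), ← Real.inv_rpow
          (by have := hy.1; positivity)]
        congr 1
        field_simp

lemma Valid.F_mem_Ioo (hp : p.Valid) (h : 3 ≤ p.Nt * p.Nr) : p.F ∈ Set.Ioo 0 1 := by
  have hQ : (0 : ℝ) < p.Q := by exact_mod_cast two_pos.trans_le (two_le_Q h)
  have := isProbabilityMeasureBeta (hp.aBeta_pos h) (hp.bBeta_pos h)
  have hz : 0 < p.d * p.τ / p.δ := div_pos (mul_pos hp.d_pos hp.τ_pos) δ_pos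
  rw [hp.F_eq_integral_betaMeasure h]
  refine integral_mem_Ioo_of_ae_mem_Ioo
    (Measurable.pow_const (by fun_prop) _).aestronglyMeasurable
    ((ae_betaMeasure_mem_Ioo _ _).mono fun y hy => ?_)
  have hbase : 1 < 1 + p.d * p.τ / p.δ * y := lt_add_of_pos_right 1 (mul_pos hz hy.1)
  exact ⟨Real.rpow_pos_of_pos (zero_lt_one.trans hbase) _,
    Real.rpow_lt_one_of_one_lt_of_neg hbase (neg_neg_of_pos hQ)⟩

/-- Probability that a stream reaches the SINR threshold under IA with `L` active pairs. -/
noncomputable def iaCoverage (p : Params) : Backhaul → ℕ → ℝ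
  | .imperfect, L => Real.exp (-(p.σ ^ 2 * p.τ / p.α)) * p.F ^ (L - 1)
  | .perfect, _ => Real.exp (-(p.σ ^ 2 * p.τ / p.α))

lemma iaRate_eq (b : Backhaul) (L : ℕ) :
    p.iaRate b L = (1 - L * p.θ) * p.d * p.R * p.iaCoverage b L := by
  cases b with
  | imperfect => simp only [iaRate, r, iaCoverage, mul_assoc]
  | perfect => rfl

lemma Valid.le_sinrIA_imperfect_iff (hp : p.Valid) {c : p.Fading} {s : Finset (Fin p.N)}
    {k : Fin p.N} {m : Fin p.d}
    (hI : ∀ i : {i // i ∈ s ∧ i ≠ k}, 0 ≤ (c.2.1 s k m i).1 * (c.2.1 s k m i).2) :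
    p.τ ≤ p.sinrIA .imperfect c s k m ↔
      p.σ ^ 2 * p.τ / p.α +
        ∑ i : {i // i ∈ s ∧ i ≠ k}, p.τ * p.d * ((c.2.1 s k m i).1 * (c.2.1 s k m i).2) ≤
          c.1 s k m := by
  have hα := hp.α_pos
  have hσ := hp.σ_pos
  have hd := hp.d_pos
  have hinterference :
      ∑ i ∈ s.erase k, p.α * (c.2.1 s k m i).1 * (p.d * (c.2.1 s k m i).2) =
        p.α * p.d * ∑ i : {i // i ∈ s ∧ i ≠ k}, (c.2.1 s k m i).1 * (c.2.1 s k m i).2 := by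
    rw [Finset.mul_sum, Finset.sum_subtype (s.erase k) fun i => by
      rw [Finset.mem_erase, and_comm]]
    exact Finset.sum_congr rfl fun i _ => by ring
  have hsum : 0 ≤ ∑ i : {i // i ∈ s ∧ i ≠ k}, (c.2.1 s k m i).1 * (c.2.1 s k m i).2 :=
    Finset.sum_nonneg fun i _ => hI i
  simp only [sinrIA]
  rw [hinterference, le_div_iff₀ (by positivity), ← Finset.mul_sum, div_add' _ _ _ hα.ne',
    div_le_iff₀ hα]
  ring_nf

lemma measurable_sinrIA (b : Backhaul) (s : Finset (Fin p.N)) (k : Fin p.N) (m : Fin p.d) :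
    Measurable fun c : p.Fading => p.sinrIA b c s k m := by
  cases b <;> unfold sinrIA <;> fun_prop

lemma measurable_snrSVD (k : Fin p.N) (m : Fin p.d) :
    Measurable fun c : p.Fading => p.snrSVD c k m := by
  unfold snrSVD
  fun_prop

lemma eigenDensity_eq {x : ℝ} (hx : 0 ≤ x) :
    p.eigenDensity x = ∑ n ∈ Finset.range p.mi, p.Omega n *
      ∑ j ∈ Finset.range (2 * n + 1), p.kappa n j *
        (x ^ ((j : ℝ) + ((p.ma - p.mi : ℕ) : ℝ) + 1 - 1) * Real.exp (-x)) := by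
  have hlaguerre_sq (n : ℕ) :
      p.laguerre n x ^ 2 = ∑ j ∈ Finset.range (2 * n + 1), p.kappa n j * x ^ j :=
    sq_sum_mul_pow (fun l hl => if_neg hl.not_ge) x
  rw [eigenDensity, if_pos hx, Finset.mul_sum]
  refine Finset.sum_congr rfl fun n _ => ?_
  rw [hlaguerre_sq, Omega, Finset.mul_sum, Finset.mul_sum, Finset.sum_mul, Finset.sum_mul,
    Finset.mul_sum]
  refine Finset.sum_congr rfl fun j _ => ?_
  rw [add_sub_cancel_right, ← Nat.cast_add, Real.rpow_natCast, pow_add]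
  ring

lemma eigenDensity_nonneg (x : ℝ) : 0 ≤ p.eigenDensity x := by
  unfold eigenDensity
  split_ifs
  · exact mul_nonneg (by positivity) (Finset.sum_nonneg fun n _ => by positivity)
  · exact le_rfl

lemma measurable_eigenDensity : Measurable p.eigenDensity := by
  unfold eigenDensity laguerre
  exact Measurable.ite measurableSet_Ici (by fun_prop) measurable_const

lemma eigenLaw_real_Ici {x : ℝ} (hx : 0 ≤ x) :
    p.eigenLaw.real (Set.Ici x) = ∑ n ∈ Finset.range p.mi, p.Omega n *
      ∑ j ∈ Finset.range (2 * n + 1), p.kappa n j *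
        upperGamma ((j : ℝ) + ((p.ma - p.mi : ℕ) : ℝ) + 1) x := by
  have hterm (j : ℕ) : IntegrableOn (fun t : ℝ =>
      t ^ ((j : ℝ) + ((p.ma - p.mi : ℕ) : ℝ) + 1 - 1) * Real.exp (-t)) (Set.Ioi x) :=
    integrableOn_rpow_mul_exp_neg (by positivity) hx
  rw [measureReal_def, eigenLaw, withDensity_apply _ measurableSet_Ici,
    ← integral_eq_lintegral_of_nonneg_ae (.of_forall eigenDensity_nonneg)
      measurable_eigenDensity.aestronglyMeasurable, integral_Ici_eq_integral_Ioi,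
    setIntegral_congr_fun measurableSet_Ioi fun t ht => eigenDensity_eq (hx.trans ht.le),
    integral_finsetSum _ fun n _ =>
      (integrable_finsetSum _ fun j _ => (hterm j).const_mul _).const_mul _]
  refine Finset.sum_congr rfl fun n _ => ?_
  rw [integral_const_mul, integral_finsetSum _ fun j _ => (hterm j).const_mul _]
  simp only [integral_const_mul, upperGamma]

section Coverage

variable {Ω : Type*} [MeasurableSpace Ω] {μ : Measure Ω}

lemma Valid.coverage_perfect (hp : p.Valid) {c : Ω → p.Fading}
    (hc : p.IsSlotFading .perfect μ c) {s : Finset (Fin p.N)} {k : Fin p.N} (hk : k ∈ s)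
    (m : Fin p.d) :
    μ.real {ω | p.τ ≤ p.sinrIA .perfect (c ω) s k m} = p.iaCoverage .perfect s.card := by
  have hα := hp.α_pos
  have hσ := hp.σ_pos
  have hτ := hp.τ_pos
  have hthreshold : {ω | p.τ ≤ p.sinrIA .perfect (c ω) s k m} =
      {ω | p.σ ^ 2 * p.τ / p.α ≤ (c ω).1 s k m} := by
    ext ω
    simp only [sinrIA, Set.mem_ofPred_eq]
    rw [le_div_iff₀ (by positivity), div_le_iff₀ hα, mul_comm p.τ, mul_comm p.α]
  rw [hthreshold, (hc.gain s k hk m).measureReal_eq (p := fun x => p.σ ^ 2 * p.τ / p.α ≤ x)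
    measurableSet_Ici]
  simpa only [one_mul] using! expMeasure_real_Ici one_pos (x := p.σ ^ 2 * p.τ / p.α)
    (by positivity)

lemma Valid.coverage_imperfect (hp : p.Valid) (h : 3 ≤ p.Nt * p.Nr) {c : Ω → p.Fading}
    (hc : p.IsSlotFading .imperfect μ c) {s : Finset (Fin p.N)} {k : Fin p.N} (hk : k ∈ s)
    (m : Fin p.d) :
    μ.real {ω | p.τ ≤ p.sinrIA .imperfect (c ω) s k m} = p.iaCoverage .imperfect s.card := by
  have hα := hp.α_pos
  have hσ := hp.σ_pos
  have hτ := hp.τ_pos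
  have hd := hp.d_pos
  have := hp.isProbabilityMeasure_interferenceLaw h
  have hlaw : HasLaw
      (fun ω => ((c ω).1 s k m, fun i : {i // i ∈ s ∧ i ≠ k} => (c ω).2.1 s k m i))
      ((expMeasure 1).prod (Measure.pi fun _ => p.interferenceLaw)) μ :=
    hc.interference rfl s k hk m
  have hnonneg : ∀ᵐ ω ∂μ, ∀ i : {i // i ∈ s ∧ i ≠ k},
      0 ≤ ((c ω).2.1 s k m i).1 * ((c ω).2.1 s k m i).2 := by
    refine ae_of_ae_map (p := fun x : ℝ × ({i // i ∈ s ∧ i ≠ k} → ℝ × ℝ) =>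
      ∀ i, 0 ≤ (x.2 i).1 * (x.2 i).2) hlaw.aemeasurable (hlaw.map_eq ▸ ?_)
    exact Measure.quasiMeasurePreserving_snd.ae <| ae_all_iff.2 fun i =>
      (Measure.tendsto_eval_ae_ae (i := i)).eventually (hp.ae_interferenceLaw_mul_nonneg h)
  have hthreshold : ({ω | p.τ ≤ p.sinrIA .imperfect (c ω) s k m} : Set Ω) =ᵐ[μ]
      {ω | p.σ ^ 2 * p.τ / p.α + ∑ i : {i // i ∈ s ∧ i ≠ k},
        p.τ * p.d * (((c ω).2.1 s k m i).1 * ((c ω).2.1 s k m i).2) ≤ (c ω).1 s k m} :=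
    hnonneg.mono fun ω hω => propext (hp.le_sinrIA_imperfect_iff hω)
  have hcard : Fintype.card {i // i ∈ s ∧ i ≠ k} = s.card - 1 := by
    rw [← Finset.card_erase_of_mem hk]
    exact Fintype.card_of_subtype _ fun i => by rw [Finset.mem_erase, and_comm]
  rw [measureReal_congr hthreshold, hlaw.measureReal_eq
    (p := fun x => p.σ ^ 2 * p.τ / p.α + ∑ i, p.τ * p.d * ((x.2 i).1 * (x.2 i).2) ≤ x.1)
    (measurableSet_le (by fun_prop) measurable_fst),
    expMeasure_prod_pi_real_add_sum_le p.interferenceLaw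
      (ψ := fun v => p.τ * p.d * (v.1 * v.2)) (by fun_prop)
      ((hp.ae_interferenceLaw_mul_nonneg h).mono fun v hv => mul_nonneg (by positivity) hv)
      one_pos (by positivity), hcard, iaCoverage]
  simp only [one_mul, hp.integral_exp_neg_interferenceLaw h]

lemma Valid.coverage_ia (hp : p.Valid) {b : Backhaul} (hb : b = .imperfect → 3 ≤ p.Nt * p.Nr)
    {c : Ω → p.Fading} (hc : p.IsSlotFading b μ c) {s : Finset (Fin p.N)} {k : Fin p.N}
    (hk : k ∈ s) (m : Fin p.d) :
    μ.real {ω | p.τ ≤ p.sinrIA b (c ω) s k m} = p.iaCoverage b s.card :=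
  match b with
  | .imperfect => hp.coverage_imperfect (hb rfl) hc hk m
  | .perfect => hp.coverage_perfect hc hk m

lemma Valid.coverage_svd (hp : p.Valid) {b : Backhaul} {c : Ω → p.Fading}
    (hc : p.IsSlotFading b μ c) (k : Fin p.N) (m : Fin p.d) :
    μ.real {ω | p.τ ≤ p.snrSVD (c ω) k m} =
      p.eigenLaw.real (Set.Ici (p.Nt * p.σ ^ 2 * p.τ / (p.ζ * p.P))) := by
  have hσ := hp.σ_pos
  have hζ := hp.ζ_pos
  have hP := hp.P_pos
  have hN : (0 : ℝ) < p.Nt := by exact_mod_cast hp.Nt_pos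
  have hthreshold : {ω | p.τ ≤ p.snrSVD (c ω) k m} =
      {ω | p.Nt * p.σ ^ 2 * p.τ / (p.ζ * p.P) ≤ (c ω).2.2 k m} := by
    ext ω
    simp only [snrSVD, Set.mem_ofPred_eq]
    rw [div_mul_eq_mul_div, le_div_iff₀ (by positivity), div_le_iff₀ (by positivity),
      mul_comm p.τ, mul_comm (p.ζ * p.P)]
  rw [hthreshold]
  exact (hc.eigen k m).measureReal_eq
    (p := fun x => p.Nt * p.σ ^ 2 * p.τ / (p.ζ * p.P) ≤ x) measurableSet_Ici

end Coverage

/-! ### Service and its mean -/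

lemma Valid.card_mul_θ_lt (hp : p.Valid) (s : Finset (Fin p.N)) : (s.card : ℝ) * p.θ < 1 := by
  have hcard : (s.card : ℝ) ≤ p.N := by exact_mod_cast card_finset_fin_le s
  exact (mul_le_mul_of_nonneg_right hcard hp.θ_pos.le).trans_lt hp.Nθ_lt

lemma Valid.θ_lt_one (hp : p.Valid) (k : Fin p.N) : p.θ < 1 := by
  simpa using hp.card_mul_θ_lt {k}

lemma mul_sum_ite_mem_Icc {ι : Type*} [Fintype ι] {x R : ℝ} (hx : x ∈ Set.Icc 0 1) (hR : 0 ≤ R)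
    (f : ι → Prop) [DecidablePred f] :
    x * ∑ m, (if f m then R else 0) ∈ Set.Icc 0 (Fintype.card ι * R) := by
  have hnonneg : 0 ≤ ∑ m, (if f m then R else 0) :=
    Finset.sum_nonneg fun m _ => by split_ifs <;> simp [hR]
  have hle : ∑ m, (if f m then R else 0) ≤ Fintype.card ι * R :=
    (Finset.sum_le_card_nsmul _ _ R fun m _ => by split_ifs <;> simp [hR]).trans_eq
      (nsmul_eq_mul _ _)
  exact ⟨mul_nonneg hx.1 hnonneg, (mul_le_of_le_one_left hnonneg hx.2).trans hle⟩

lemma Valid.service_mem_Icc (hp : p.Valid) (b : Backhaul) (c : p.Fading) (D : Decision p.N)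
    (k : Fin p.N) : p.service b c D k ∈ Set.Icc 0 (p.d * p.R) := by
  have hR := hp.R_pos.le
  have hdR : (0 : ℝ) ∈ Set.Icc 0 (p.d * p.R) := ⟨le_rfl, by positivity⟩
  cases D with
  | ia s =>
    have hoverhead : 0 ≤ (s.card : ℝ) * p.θ := mul_nonneg (by positivity) hp.θ_pos.le
    simp only [service]
    split_ifs
    · simpa using mul_sum_ite_mem_Icc
        ⟨sub_nonneg.2 (hp.card_mul_θ_lt s).le, sub_le_self _ hoverhead⟩ hR
        fun m => p.τ ≤ p.sinrIA b c s k m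
    · exact hdR
  | svd j =>
    simp only [service]
    split_ifs
    · simpa using mul_sum_ite_mem_Icc
        ⟨sub_nonneg.2 (hp.θ_lt_one j).le, sub_le_self _ hp.θ_pos.le⟩ hR
        fun m => p.τ ≤ p.snrSVD c k m
    · exact hdR

lemma measurable_service (b : Backhaul) (D : Decision p.N) (k : Fin p.N) :
    Measurable fun c : p.Fading => p.service b c D k := by
  cases D <;> simp only [service] <;> split_ifs
  · exact (Finset.measurable_fun_sum _ fun m _ => Measurable.ite (measurableSet_le
      measurable_const (measurable_sinrIA b _ k m)) measurable_const measurable_const).const_mul _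
  · exact measurable_const
  · exact (Finset.measurable_fun_sum _ fun m _ => Measurable.ite (measurableSet_le
      measurable_const (measurable_snrSVD k m)) measurable_const measurable_const).const_mul _
  · exact measurable_const

/-- Mean service vector of a decision. -/
noncomputable def rate (p : Params) (b : Backhaul) : Decision p.N → Fin p.N → ℝ
  | .ia s => p.iaRate b s.card • indVec s
  | .svd j => p.rsvd • indVec {j}

lemma Valid.integral_service {Ω : Type*} [MeasurableSpace Ω] {μ : Measure Ω} [IsFiniteMeasure μ]
    (hp : p.Valid) {b : Backhaul} (hb : b = .imperfect → 3 ≤ p.Nt * p.Nr) {c : Ω → p.Fading}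
    (hc : p.IsSlotFading b μ c) (D : Decision p.N) (k : Fin p.N) :
    ∫ ω, p.service b (c ω) D k ∂μ = p.rate b D k := by
  have hσ := hp.σ_pos
  have hζ := hp.ζ_pos
  have hP := hp.P_pos
  have hτ := hp.τ_pos
  cases D with
  | ia s =>
    simp only [service, rate, Pi.smul_apply, indVec, smul_eq_mul]
    split_ifs with hk
    · rw [integral_mul_sum_ite (f := fun m ω => p.τ ≤ p.sinrIA b (c ω) s k m)
        (fun m => measurableSet_le measurable_const
          ((measurable_sinrIA b s k m).comp hc.measurable))
        (hp.coverage_ia hb hc hk), Fintype.card_fin, mul_one, iaRate_eq]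
    · rw [integral_zero, mul_zero]
  | svd j =>
    simp only [service, rate, Pi.smul_apply, indVec, smul_eq_mul, Finset.mem_singleton]
    split_ifs with hk
    · rw [integral_mul_sum_ite (f := fun m ω => p.τ ≤ p.snrSVD (c ω) k m)
        (fun m => measurableSet_le measurable_const ((measurable_snrSVD k m).comp hc.measurable))
        (hp.coverage_svd hc k), Fintype.card_fin, mul_one, eigenLaw_real_Ici (by positivity), rsvd]
    · rw [integral_zero, mul_zero]

end Params

/-! ### Coordinate-convex polytopes -/

section Geometry

variable {ι : Type*}

lemma IsCoordinateConvex.of_update_zero_mem [Finite ι] [DecidableEq ι] {Λ : Set (ι → ℝ)}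
    (hΛ : Convex ℝ Λ) (hupdate : ∀ x ∈ Λ, ∀ k, Function.update x k 0 ∈ Λ) :
    IsCoordinateConvex Λ := by
  intro x hx y hy
  have := Fintype.ofFinite ι
  have hpiecewise (T : Finset ι) : T.piecewise y x ∈ Λ := by
    induction T using Finset.induction_on with
    | empty => simpa only [Finset.piecewise_empty] using hx
    | insert k T hk ih =>
      have hyk : y k / x k * x k = y k :=
        div_mul_cancel_of_imp fun h => le_antisymm (h ▸ hy.2 k) (hy.1 k)
      have hcomb : (insert k T).piecewise y x = (y k / x k) • T.piecewise y x +
          (1 - y k / x k) • Function.update (T.piecewise y x) k 0 := by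
        rw [Finset.piecewise_insert]
        ext i
        rcases eq_or_ne i k with rfl | hi
        · simp [hk, hyk]
        · simp only [Pi.add_apply, Pi.smul_apply, smul_eq_mul, Function.update_of_ne hi]
          ring
      rw [hcomb]
      exact hΛ ih (hupdate _ ih k) (div_nonneg (hy.1 k) ((hy.1 k).trans (hy.2 k)))
        (sub_nonneg.2 (div_le_one_of_le₀ (hy.2 k) ((hy.1 k).trans (hy.2 k)))) (by ring)
  simpa only [Finset.piecewise_univ] using hpiecewise Finset.univ

lemma isCoordinateConvex_closedConvexHull [Finite ι] [DecidableEq ι] {V : Set (ι → ℝ)}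
    (hV : ∀ v ∈ V, ∀ k, Function.update v k 0 ∈ closedConvexHull ℝ V) :
    IsCoordinateConvex (closedConvexHull ℝ V) := by
  refine .of_update_zero_mem convex_closedConvexHull fun x hx k => ?_
  let zeroAt : (ι → ℝ) →ₗ[ℝ] ι → ℝ :=
    { toFun := fun x => Function.update x k 0
      map_add' := fun x y => by rw [← Function.update_add, add_zero]
      map_smul' := fun c x => by rw [RingHom.id_apply, ← Function.update_smul, smul_zero] }
  exact closedConvexHull_min (fun v hv => hV v hv k)
    (convex_closedConvexHull.linear_preimage zeroAt)
    (isClosed_closedConvexHull.preimage (continuous_id.update k continuous_const)) hx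

lemma sum_mul_le_of_mem_closedConvexHull [Fintype ι] {V : Set (ι → ℝ)} {q : ι → ℝ} {w : ℝ}
    (hV : ∀ v ∈ V, ∑ k, q k * v k ≤ w) {x : ι → ℝ} (hx : x ∈ closedConvexHull ℝ V) :
    ∑ k, q k * x k ≤ w :=
  closedConvexHull_min (t := {x : ι → ℝ | ∑ k, q k * x k ≤ w}) hV
    (convex_halfSpace_le
      ⟨fun x y => by simp only [Pi.add_apply, mul_add, Finset.sum_add_distrib],
        fun c x => by simp only [Pi.smul_apply, smul_eq_mul, Finset.mul_sum, mul_left_comm]⟩ w)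
    (isClosed_le (by fun_prop) continuous_const) hx

end Geometry

section Indicator

variable {N : ℕ}

lemma indVec_empty : indVec (∅ : Finset (Fin N)) = 0 := by
  ext k
  exact if_neg (Finset.notMem_empty k)

lemma update_smul_indVec (u : ℝ) (s : Finset (Fin N)) (k : Fin N) :
    Function.update (u • indVec s) k 0 = u • indVec (s.erase k) := by
  ext i
  rcases eq_or_ne i k with rfl | hi <;> simp [indVec, *]

lemma sum_indVec_erase (s : Finset (Fin N)) :
    ∑ j ∈ s, indVec (s.erase j) = ((s.card : ℝ) - 1) • indVec s := by
  ext k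
  have hsplit : ∀ j ∈ s, indVec (s.erase j) k = indVec s k - if k = j then 1 else 0 := by
    intro j hj
    rcases eq_or_ne k j with rfl | hkj <;> simp [indVec, *]
  rw [Finset.sum_apply, Finset.sum_congr rfl hsplit, Finset.sum_sub_distrib, Finset.sum_const,
    Finset.sum_ite_eq, nsmul_eq_mul]
  simp only [Pi.smul_apply, smul_eq_mul, indVec]
  ring

/-- Removing the elements of `s` one at a time writes the indicator of `s` as an average. -/
lemma smul_indVec_mem_of_card_le {Λ : Set (Fin N → ℝ)} (hΛ : Convex ℝ Λ) {g : ℝ} {M : ℕ}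
    (hM : 1 ≤ M) (hcard : ∀ s : Finset (Fin N), s.card = M → (g / M) • indVec s ∈ Λ)
    (s : Finset (Fin N)) (hs : M ≤ s.card) : (g / s.card) • indVec s ∈ Λ := by
  generalize hL : s.card = L at hs ⊢
  induction L, hs using Nat.le_induction generalizing s with
  | base => exact hcard s hL
  | succ L hL' ih =>
    have hL₀ : (0 : ℝ) < L := by exact_mod_cast hM.trans hL'
    have herase (j) (hj : j ∈ s) : (g / L) • indVec (s.erase j) ∈ Λ :=
      ih _ (by rw [Finset.card_erase_of_mem hj, hL, Nat.add_sub_cancel])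
    convert! hΛ.sum_mem (t := s) (w := fun _ => ((L : ℝ) + 1)⁻¹) (fun _ _ => by positivity)
      (by rw [Finset.sum_const, hL, nsmul_eq_mul]; push_cast; field_simp) herase using 1
    rw [← Finset.smul_sum, ← Finset.smul_sum, sum_indVec_erase, hL, smul_smul, smul_smul]
    congr 1
    push_cast
    field_simp
    ring

end Indicator

/-! ### Total rate of interference alignment -/

lemma le_bestInteger_of_antitoneOn {f : ℕ → ℝ} {g : ℝ → ℝ} {x y C : ℝ}
    (hg : AntitoneOn g (Set.Icc x y)) (hC : 0 ≤ C) (hfg : ∀ n : ℕ, x ≤ n → f n = C * g n) {L : ℕ}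
    (hL : bestInteger f x < L) (hLy : L ≤ y) : f L ≤ f (bestInteger f x) := by
  have hceil (h : ⌈x⌉₊ ≤ L) : f L ≤ f ⌈x⌉₊ := by
    have hxL : (⌈x⌉₊ : ℝ) ≤ L := by exact_mod_cast h
    have hx : x ≤ ⌈x⌉₊ := Nat.le_ceil x
    rw [hfg _ hx, hfg L (hx.trans hxL)]
    exact mul_le_mul_of_nonneg_left (hg ⟨hx, hxL.trans hLy⟩ ⟨hx.trans hxL, hLy⟩ hxL) hC
  unfold bestInteger at hL ⊢
  split_ifs at hL ⊢ with hbest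
  · exact hceil hL.le
  · exact (hceil ((Nat.ceil_le_floor_add_one x).trans hL)).trans (not_le.1 hbest).le

lemma antitoneOn_mul_one_sub_mul {θ : ℝ} (hθ : 0 < θ) :
    AntitoneOn (fun x : ℝ => x * (1 - x * θ)) (Set.Ici (1 / (2 * θ))) := by
  intro x hx y hy hxy
  have hx' : 1 ≤ x * (2 * θ) := (div_le_iff₀ (by positivity)).1 hx
  have hy' : 1 ≤ y * (2 * θ) := (div_le_iff₀ (by positivity)).1 hy
  refine sub_nonneg.1 ?_
  calc 0 ≤ (y - x) * ((x + y) * θ - 1) := mul_nonneg (sub_nonneg.2 hxy) (by linarith)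
    _ = x * (1 - x * θ) - y * (1 - y * θ) := by ring

/-- The smaller critical point of `x ↦ x (1 - x θ) e^{l (x - 1)}` for `l < 0 < θ`; at
`l = log F` it is `L₀`. -/
noncomputable def totalRatePeak (θ l : ℝ) : ℝ :=
  (1 / θ - 2 / l - √((2 / l - 1 / θ) ^ 2 + 4 / (θ * l))) / 2

section TotalRate

variable {θ l : ℝ} (hθ : 0 < θ) (hl : l < 0)

include hl in
lemma totalRatePeak_eq (hθ : θ ≠ 0) :
    totalRatePeak θ l = (1 / θ - 2 / l - √((1 / θ) ^ 2 + (2 / l) ^ 2)) / 2 := by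
  have hdiscr : (2 / l - 1 / θ) ^ 2 + 4 / (θ * l) = (1 / θ) ^ 2 + (2 / l) ^ 2 := by
    have := hl.ne
    field_simp
    ring
  rw [totalRatePeak, hdiscr]

include hθ hl

lemma totalRatePeak_pos : 0 < totalRatePeak θ l := by
  have hθ' : 0 < 1 / θ := one_div_pos.2 hθ
  have hl' : 2 / l < 0 := div_neg_of_pos_of_neg two_pos hl
  rw [totalRatePeak_eq hl hθ.ne']
  have hsqrt : √((1 / θ) ^ 2 + (2 / l) ^ 2) < 1 / θ - 2 / l :=
    (Real.sqrt_lt' (by linarith)).2 (by nlinarith [mul_neg_of_pos_of_neg hθ' hl'])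
  linarith

lemma totalRatePeak_le : totalRatePeak θ l ≤ -(2 / l) := by
  have hl' : 2 / l < 0 := div_neg_of_pos_of_neg two_pos hl
  have hsqrt : 1 / θ ≤ √((1 / θ) ^ 2 + (2 / l) ^ 2) :=
    Real.le_sqrt_of_sq_le (le_add_of_nonneg_right (sq_nonneg _))
  rw [totalRatePeak_eq hl hθ.ne']
  linarith

lemma critical_eq_mul_sub_totalRatePeak (x : ℝ) :
    1 - 2 * θ * x + l * x * (1 - θ * x) =
      -l * θ * ((x - totalRatePeak θ l) * (x - (1 / θ - 2 / l - totalRatePeak θ l))) := by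
  have hsq : √((1 / θ) ^ 2 + (2 / l) ^ 2) ^ 2 = (1 / θ) ^ 2 + (2 / l) ^ 2 :=
    Real.sq_sqrt (by positivity)
  have hvieta : totalRatePeak θ l * (1 / θ - 2 / l - totalRatePeak θ l) = -(1 / (l * θ)) := by
    rw [totalRatePeak_eq hl hθ.ne']
    calc _ = ((1 / θ - 2 / l) ^ 2 - √((1 / θ) ^ 2 + (2 / l) ^ 2) ^ 2) / 4 := by ring
      _ = -(1 / (l * θ)) := by rw [hsq]; ring
  calc 1 - 2 * θ * x + l * x * (1 - θ * x)
      = -l * θ * (x ^ 2 - (1 / θ - 2 / l) * x + -(1 / (l * θ))) := by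
        have := hl.ne
        field_simp
        ring
    _ = _ := by rw [← hvieta]; ring

lemma antitoneOn_mul_one_sub_mul_mul_exp :
    AntitoneOn (fun x : ℝ => x * (1 - x * θ) * Real.exp (l * (x - 1)))
      (Set.Icc (totalRatePeak θ l) (1 / θ)) := by
  have hderiv (x : ℝ) : HasDerivAt (fun x : ℝ => x * (1 - x * θ) * Real.exp (l * (x - 1)))
      ((1 - 2 * θ * x + l * x * (1 - θ * x)) * Real.exp (l * (x - 1))) x := by
    have hpoly : HasDerivAt (fun x : ℝ => x * (1 - x * θ))
        (1 * (1 - x * θ) + x * (-(1 * θ))) x :=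
      (hasDerivAt_id x).mul (((hasDerivAt_id x).mul_const θ).const_sub 1)
    have hexp : HasDerivAt (fun x : ℝ => Real.exp (l * (x - 1)))
        (Real.exp (l * (x - 1)) * (l * 1)) x :=
      (((hasDerivAt_id x).sub_const 1).const_mul l).exp
    convert! hpoly.mul hexp using 1
    ring
  refine antitoneOn_of_deriv_nonpos (convex_Icc _ _)
    (fun x _ => (hderiv x).continuousAt.continuousWithinAt)
    (fun x _ => (hderiv x).differentiableAt.differentiableWithinAt) fun x hx => ?_
  rw [interior_Icc] at hx
  rw [(hderiv x).deriv, critical_eq_mul_sub_totalRatePeak hθ hl]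
  have hbelow : x - (1 / θ - 2 / l - totalRatePeak θ l) ≤ 0 := by
    linarith [hx.2, totalRatePeak_le hθ hl]
  exact mul_nonpos_of_nonpos_of_nonneg (mul_nonpos_of_nonneg_of_nonpos
    (mul_nonneg (neg_nonneg.2 hl.le) hθ.le)
    (mul_nonpos_of_nonneg_of_nonpos (sub_nonneg.2 hx.1.le) hbelow)) (Real.exp_pos _).le

end TotalRate

namespace Params

variable {p : Params}

section Rates

variable (hp : p.Valid) {b : Backhaul} (hb : b = .imperfect → 3 ≤ p.Nt * p.Nr)
include hp hb

lemma Valid.iaCoverage_pos (L : ℕ) : 0 < p.iaCoverage b L :=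
  match b with
  | .imperfect => mul_pos (Real.exp_pos _) (pow_pos (hp.F_mem_Ioo (hb rfl)).1 _)
  | .perfect => Real.exp_pos _

lemma Valid.antitone_iaCoverage : Antitone (p.iaCoverage b) := by
  intro M L hML
  cases b with
  | imperfect =>
    have hF := hp.F_mem_Ioo (hb rfl)
    exact mul_le_mul_of_nonneg_left
      (pow_le_pow_of_le_one hF.1.le hF.2.le (Nat.sub_le_sub_right hML 1)) (Real.exp_pos _).le
  | perfect => exact le_rfl

lemma Valid.iaRate_card_pos (s : Finset (Fin p.N)) : 0 < p.iaRate b s.card := by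
  rw [iaRate_eq]
  exact mul_pos (mul_pos (mul_pos (sub_pos.2 (hp.card_mul_θ_lt s)) hp.d_pos) hp.R_pos)
    (hp.iaCoverage_pos hb _)

lemma Valid.iaRate_card_le {s t : Finset (Fin p.N)} (hst : s ⊆ t) :
    p.iaRate b t.card ≤ p.iaRate b s.card := by
  have hR := hp.R_pos.le
  have hcard : (s.card : ℝ) ≤ t.card := by exact_mod_cast Finset.card_le_card hst
  have hoverhead : 0 ≤ 1 - s.card * p.θ := sub_nonneg.2 (hp.card_mul_θ_lt s).le
  rw [iaRate_eq, iaRate_eq]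
  refine mul_le_mul ?_ (hp.antitone_iaCoverage hb (Finset.card_le_card hst))
    (hp.iaCoverage_pos hb _).le (by positivity)
  have := hp.θ_pos
  gcongr

lemma Valid.total_iaRate_le {s : Finset (Fin p.N)} (hs : p.Lmax b < s.card) :
    s.card * p.iaRate b s.card ≤ p.Lmax b * p.iaRate b (p.Lmax b) := by
  have hθ := hp.θ_pos
  have hle : (s.card : ℝ) ≤ 1 / p.θ := (le_div_iff₀ hθ).2 (hp.card_mul_θ_lt s).le
  have hC : 0 ≤ p.d * p.R * Real.exp (-(p.σ ^ 2 * p.τ / p.α)) :=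
    mul_nonneg (mul_nonneg hp.d_pos.le hp.R_pos.le) (Real.exp_pos _).le
  cases b with
  | imperfect =>
    obtain ⟨hF₀, hF₁⟩ := hp.F_mem_Ioo (hb rfl)
    have hlog := Real.log_neg hF₀ hF₁
    refine le_bestInteger_of_antitoneOn (f := fun L => (L : ℝ) * p.r L)
      (antitoneOn_mul_one_sub_mul_mul_exp hθ hlog) hC (fun n hn => ?_) hs hle
    have hone : 1 ≤ n := by exact_mod_cast (totalRatePeak_pos hθ hlog).trans_le hn
    simp only [r]
    rw [Real.exp_mul, Real.exp_log hF₀, ← Nat.cast_one, ← Nat.cast_sub hone,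
      Real.rpow_natCast]
    ring
  | perfect =>
    refine le_bestInteger_of_antitoneOn (f := fun L => (L : ℝ) * p.mu L)
      ((antitoneOn_mul_one_sub_mul hθ).mono Set.Icc_subset_Ici_self) hC
      (fun n _ => ?_) hs hle
    simp only [mu]
    ring

end Rates

/-! ### The rate region -/

lemma weight_eq (b : Backhaul) (q : Fin p.N → ℝ) (D : Decision p.N) :
    p.weight b q D = ∑ k, q k * p.rate b D k := by
  cases D <;> simp [weight, rate, indVec, Finset.sum_mul, Finset.sum_ite_mem, mul_comm]

lemma region_eq_closedConvexHull_rate (b : Backhaul) :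
    p.region b = closedConvexHull ℝ
      ((fun s => p.rate b (.ia s)) '' {s | s.card ≤ p.Lmax b} ∪
        Set.range fun j => p.rate b (.svd j)) := by
  rw [region]
  congr 2
  · ext x
    simp only [iaPoints, S, Set.mem_union, Set.mem_singleton_iff, Set.mem_iUnion,
      Finset.mem_Icc, Set.mem_ofPred_eq, Set.mem_image, rate]
    constructor
    · rintro (rfl | ⟨L, hL, _, ⟨s, rfl, rfl⟩, rfl⟩)
      · exact ⟨∅, Nat.zero_le _, by rw [indVec_empty, smul_zero]⟩
      · exact ⟨s, hL.2, rfl⟩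
    · rintro ⟨s, hs, rfl⟩
      rcases s.eq_empty_or_nonempty with rfl | hne
      · exact .inl (by rw [indVec_empty, smul_zero])
      · exact .inr ⟨s.card, ⟨hne.card_pos, hs⟩, _, ⟨s, rfl, rfl⟩, rfl⟩
  · ext x
    simp only [J1, S, Set.mem_ofPred_eq, Set.mem_range, rate]
    constructor
    · rintro ⟨_, ⟨s, hs, rfl⟩, rfl⟩
      obtain ⟨j, rfl⟩ := Finset.card_eq_one.1 hs
      exact ⟨j, rfl⟩
    · rintro ⟨j, rfl⟩
      exact ⟨_, ⟨{j}, Finset.card_singleton j, rfl⟩, rfl⟩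

lemma convex_region (b : Backhaul) : Convex ℝ (p.region b) := convex_closedConvexHull

lemma isClosed_region (b : Backhaul) : IsClosed (p.region b) := isClosed_closedConvexHull

lemma rate_ia_mem_region {b : Backhaul} {s : Finset (Fin p.N)} (hs : s.card ≤ p.Lmax b) :
    p.rate b (.ia s) ∈ p.region b := by
  rw [region_eq_closedConvexHull_rate]
  exact subset_closedConvexHull (.inl ⟨s, hs, rfl⟩)

lemma rate_svd_mem_region (b : Backhaul) (j : Fin p.N) : p.rate b (.svd j) ∈ p.region b := by
  rw [region_eq_closedConvexHull_rate]
  exact subset_closedConvexHull (.inr ⟨j, rfl⟩)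

lemma zero_mem_region (b : Backhaul) : (0 : Fin p.N → ℝ) ∈ p.region b :=
  subset_closedConvexHull (.inl (.inl rfl))

lemma sum_mul_le_of_mem_region {b : Backhaul} {q : Fin p.N → ℝ} {w : ℝ}
    (hw : ∀ D, p.weight b q D ≤ w) {x : Fin p.N → ℝ} (hx : x ∈ p.region b) :
    ∑ k, q k * x k ≤ w := by
  rw [region_eq_closedConvexHull_rate] at hx
  refine sum_mul_le_of_mem_closedConvexHull ?_ hx
  rintro _ (⟨s, -, rfl⟩ | ⟨j, rfl⟩) <;> exact (weight_eq b q _).symm.trans_le (hw _)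

section Region

variable (hp : p.Valid) {b : Backhaul} (hb : b = .imperfect → 3 ≤ p.Nt * p.Nr)
include hp hb

lemma Valid.smul_indVec_mem_region {u : ℝ} (hu : 0 ≤ u) {s : Finset (Fin p.N)}
    (hs : s.card ≤ p.Lmax b) (hus : u ≤ p.iaRate b s.card) : u • indVec s ∈ p.region b := by
  have hpos := hp.iaRate_card_pos hb s
  have hmem := (convex_region b).smul_mem_of_zero_mem (zero_mem_region b) (rate_ia_mem_region hs)
    ⟨div_nonneg hu hpos.le, (div_le_one hpos).2 hus⟩
  rwa [rate, smul_smul, div_mul_cancel₀ _ hpos.ne'] at hmem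

lemma Valid.isCoordinateConvex_region : IsCoordinateConvex (p.region b) := by
  have hupdate : ∀ v ∈ (fun s => p.rate b (.ia s)) '' {s | s.card ≤ p.Lmax b} ∪
      Set.range (fun j => p.rate b (.svd j)), ∀ k, Function.update v k 0 ∈ p.region b := by
    rintro _ (⟨s, hs, rfl⟩ | ⟨j, rfl⟩) k
    · simp only [rate, update_smul_indVec]
      exact hp.smul_indVec_mem_region hb (hp.iaRate_card_pos hb s).le
        ((Finset.card_erase_le).trans hs) (hp.iaRate_card_le hb (s.erase_subset k))
    · simp only [rate, update_smul_indVec]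
      rcases eq_or_ne k j with rfl | hkj
      · rw [Finset.erase_singleton, indVec_empty, smul_zero]
        exact zero_mem_region b
      · rw [Finset.erase_eq_of_notMem (Finset.notMem_singleton.2 hkj)]
        exact rate_svd_mem_region b j
  rw [region_eq_closedConvexHull_rate] at hupdate ⊢
  exact isCoordinateConvex_closedConvexHull hupdate

lemma Valid.rate_mem_region (D : Decision p.N) : p.rate b D ∈ p.region b := by
  rcases D with s | j
  swap
  · exact rate_svd_mem_region b j
  rcases le_or_gt s.card (p.Lmax b) with hs | hs
  · exact rate_ia_mem_region hs
  have hs₀ : (0 : ℝ) < s.card := by exact_mod_cast (Nat.zero_le _).trans_lt hs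
  have hpos := hp.iaRate_card_pos hb s
  have htotal := hp.total_iaRate_le hb hs
  have hLmax : 1 ≤ p.Lmax b := by
    refine Nat.one_le_iff_ne_zero.2 fun h => (mul_pos hs₀ hpos).not_ge ?_
    simpa [h] using htotal
  have hmem := smul_indVec_mem_of_card_le (convex_region b)
    (g := p.Lmax b * p.iaRate b (p.Lmax b)) hLmax (fun t ht => by
      rw [mul_div_cancel_left₀ _ (by positivity), ← ht]
      exact rate_ia_mem_region ht.le) s hs.le
  have hindVec : 0 ≤ indVec s := fun k => by unfold indVec; split_ifs <;> simp
  exact hp.isCoordinateConvex_region hb _ hmem ⟨smul_nonneg hpos.le hindVec,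
    smul_le_smul_of_nonneg_right ((le_div_iff₀' hs₀).2 htotal) hindVec⟩

end Region

end Params
/-! ### Strong stability of the network -/

lemma limsup_average_lt_top_iff {u : ℕ → ℝ} (hu : ∀ t, 0 ≤ u t) :
    limsup (fun T : ℕ => (∑ t ∈ Finset.range T, ENNReal.ofReal (u t)) / (T : ENNReal)) atTop < ⊤ ↔
      HasBoundedAverage u := by
  have haverage : ∀ T : ℕ, 1 ≤ T → (∑ t ∈ Finset.range T, ENNReal.ofReal (u t)) / (T : ENNReal) =
      ENNReal.ofReal ((∑ t ∈ Finset.range T, u t) / T) := fun T hT => by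
    rw [ENNReal.ofReal_div_of_pos (by positivity), ENNReal.ofReal_natCast,
      ENNReal.ofReal_sum_of_nonneg fun t _ => hu t]
  constructor
  · intro h
    obtain ⟨M, hM, -⟩ := ENNReal.lt_iff_exists_nnreal_btwn.1 h
    refine ⟨M, ?_⟩
    filter_upwards [eventually_ge_atTop 1, eventually_lt_of_limsup_lt hM] with T hT hlt
    rw [haverage T hT, ← ENNReal.ofReal_coe_nnreal] at hlt
    exact ((div_lt_iff₀ (by positivity)).1 (ENNReal.ofReal_lt_ofReal_iff'.1 hlt).1).le
  · rintro ⟨M, hM⟩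
    refine (limsup_le_of_le (a := ENNReal.ofReal M) (by isBoundedDefault) ?_).trans_lt
      ENNReal.ofReal_lt_top
    filter_upwards [eventually_ge_atTop 1, hM] with T hT hle
    rw [haverage T hT]
    exact ENNReal.ofReal_le_ofReal ((div_le_iff₀ (by positivity)).2 hle)

variable {Ω : Type*} [MeasurableSpace Ω] {μ : Measure Ω}

lemma stronglyStable_iff_hasBoundedAverage {N : ℕ} {q : ℕ → Ω → Fin N → ℝ}
    (hint : ∀ t k, Integrable (fun ω => q t ω k) μ) (hnonneg : ∀ t, ∀ᵐ ω ∂μ, 0 ≤ q t ω) :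
    StronglyStable μ q ↔ ∀ k, HasBoundedAverage fun t => ∫ ω, q t ω k ∂μ := by
  have hk : ∀ t k, 0 ≤ᵐ[μ] fun ω => q t ω k := fun t k => (hnonneg t).mono fun _ hω => hω k
  refine forall_congr' fun k => ?_
  simp only [← limsup_average_lt_top_iff fun t => integral_nonneg_of_ae (hk t k),
    ofReal_integral_eq_lintegral_ofReal (hint _ k) (hk _ k)]

lemma iIndepFun_const [IsProbabilityMeasure μ] {ι : Type*} [Finite ι] {β : ι → Type*}
    [∀ i, MeasurableSpace (β i)] (x : ∀ i, β i) : iIndepFun (fun i (_ : Ω) => x i) μ := by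
  have := Fintype.ofFinite ι
  rw [iIndepFun_iff_map_fun_eq_pi_map fun i => aemeasurable_const]
  refine (Measure.pi_eq fun s hs => ?_).symm
  classical
  simp [Measure.dirac_apply', hs, MeasurableSet.univ_pi, Set.indicator_apply, Finset.prod_ite_zero]

lemma exists_add_mem_of_mem_orthantInterior {N : ℕ} {Λ : Set (Fin N → ℝ)} {a : Fin N → ℝ}
    (ha : a ∈ orthantInterior Λ) : ∃ ε > 0, (fun k => a k + ε) ∈ Λ := by
  have hcont : Continuous fun (ε : ℝ) k => a k + ε := by fun_prop
  have htendsto : Tendsto (fun (ε : ℝ) k => a k + ε) (𝓝[>] 0) (𝓝[{x | ∀ k, 0 ≤ x k}] a) := by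
    refine tendsto_nhdsWithin_iff.2 ⟨?_, ?_⟩
    · simpa using (hcont.tendsto 0).mono_left nhdsWithin_le_nhds
    · filter_upwards [self_mem_nhdsWithin] with ε hε k
      exact add_nonneg (ha.1 k) (Set.mem_Ioi.1 hε).le
  obtain ⟨ε, hmem, hε⟩ := ((htendsto.eventually ha.2).and self_mem_nhdsWithin).exists
  exact ⟨ε, hε, hmem⟩

namespace Params

variable {p : Params} {b : Backhaul} {c : ℕ → Ω → p.Fading} {π : Policy p.N} {a : Fin p.N → ℝ}
  {A : ℕ → Ω → Fin p.N → ℝ} {q₀ : Fin p.N → ℝ}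

/-- The service offered by the policy `π` at queue lengths `q`, in a slot whose state `x` consists
of the arrivals and of the fading variables. -/
noncomputable def policyService (p : Params) (b : Backhaul) (π : Policy p.N) (q : Fin p.N → ℝ)
    (x : (Fin p.N → ℝ) × p.Fading) : Fin p.N → ℝ :=
  p.service b x.2 (π q)

lemma measurable_policyService (b : Backhaul) (hπ : π.IsMeasurable) :
    Measurable (Function.uncurry (p.policyService b π)) := by
  let : MeasurableSpace (Decision p.N) := ⊤
  have : Countable (Decision p.N) :=
    Function.Surjective.countable (f := Sum.elim Decision.ia Decision.svd) <| by
      rintro (s | j)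
      exacts [⟨.inl s, rfl⟩, ⟨.inr j, rfl⟩]
  have hservice : Measurable fun z : Decision p.N × p.Fading => p.service b z.2 z.1 :=
    measurable_from_prod_countable_right fun D =>
      measurable_pi_lambda _ fun k => measurable_service b D k
  have hπ' : Measurable π := measurable_to_countable' hπ
  exact hservice.comp ((hπ'.comp measurable_fst).prodMk (measurable_snd.comp measurable_snd))

omit [MeasurableSpace Ω] in
lemma queue_eq_queueLength (t : ℕ) (ω : Ω) :
    p.queue b c π A q₀ t ω =
      queueLength Prod.fst (p.policyService b π) (fun t ω => (A t ω, c t ω)) q₀ t ω := by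
  induction t with
  | zero => rfl
  | succ t ih =>
    rw [queue, queueLength, ih]
    rfl

lemma isArrival_const [IsProbabilityMeasure μ] (hslots : iIndepFun c μ) (ha : ∀ k, 0 ≤ a k) :
    p.IsArrival μ c a fun _ _ => a where
  measurable _ := measurable_const
  bounded := ⟨∑ k, a k + 1, fun _ k => ae_of_all _ fun _ => ⟨ha k,
    (Finset.single_le_sum (fun i _ => ha i) (Finset.mem_univ k)).trans_lt (lt_add_one _)⟩⟩
  users _ := iIndepFun_const a
  ident _ _ := .refl aemeasurable_const
  mean _ _ := by simp
  slots := hslots.comp (fun _ x => (a, x)) fun _ => measurable_const.prodMk measurable_id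

section Stability

variable [IsProbabilityMeasure μ] (hp : p.Valid) (hb : b = .imperfect → 3 ≤ p.Nt * p.Nr)
  (hc : ∀ t, p.IsSlotFading b μ (c t)) (hA : p.IsArrival μ c a A)
include hp hb hc

include hA in
lemma Valid.exists_slottedQueues (hπ : π.IsMeasurable) :
    ∃ K, SlottedQueues μ (fun t ω => (A t ω, c t ω)) Prod.fst (p.policyService b π) a
      (fun q => p.rate b (π q)) K := by
  obtain ⟨M, hM⟩ := hA.bounded
  refine ⟨max M (p.d * p.R), ?_⟩
  exact
  { measurable_state := fun t => (hA.measurable t).prodMk (hc t).measurable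
    indep := hA.slots
    measurable_arrival := measurable_fst
    measurable_service := measurable_policyService b hπ
    arrival_mem := ae_all_iff.2 fun t => ae_all_iff.2 fun k => (hM t k).mono fun _ hω =>
      ⟨hω.1, hω.2.le.trans (le_max_left _ _)⟩
    service_mem := fun q x k =>
      Set.Icc_subset_Icc_right (le_max_right _ _) (hp.service_mem_Icc b x.2 (π q) k)
    integral_arrival := hA.mean
    integral_service := fun t q k => hp.integral_service hb (hc t) (π q) k }

include hA in
lemma Valid.stronglyStable_queue_iff (hπ : π.IsMeasurable) (hq₀ : 0 ≤ q₀) :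
    StronglyStable μ (p.queue b c π A q₀) ↔
      ∀ k, HasBoundedAverage fun t => ∫ ω, p.queue b c π A q₀ t ω k ∂μ := by
  obtain ⟨K, h⟩ := hp.exists_slottedQueues hb hc hA hπ
  refine stronglyStable_iff_hasBoundedAverage ?_ ?_ <;> simp only [queue_eq_queueLength]
  exacts [h.integrable_queueLength hq₀, h.queueLength_nonneg hq₀]

include hA in
theorem Valid.stronglyStable_of_isSwitchingPolicy (hπ : p.IsSwitchingPolicy b π) (hq₀ : 0 ≤ q₀)
    (ha : a ∈ orthantInterior (p.region b)) : StronglyStable μ (p.queue b c π A q₀) := by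
  obtain ⟨K, h⟩ := hp.exists_slottedQueues hb hc hA hπ.1
  obtain ⟨ε, hε, hmem⟩ := exists_add_mem_of_mem_orthantInterior ha
  have hgap : ∀ q, 0 ≤ q → ∑ k, q k * (a k + ε) ≤ ∑ k, q k * p.rate b (π q) k := fun q hq =>
    (sum_mul_le_of_mem_region (hπ.2 q hq) hmem).trans_eq (weight_eq b q (π q))
  rw [hp.stronglyStable_queue_iff hb hc hA hπ.1 hq₀]
  simpa only [queue_eq_queueLength] using h.hasBoundedAverage_of_gap hq₀ hε hgap

include hA in
theorem Valid.mem_region_of_stronglyStable (hπ : π.IsMeasurable) (hq₀ : 0 ≤ q₀)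
    (hstable : StronglyStable μ (p.queue b c π A q₀)) : a ∈ p.region b := by
  obtain ⟨K, h⟩ := hp.exists_slottedQueues hb hc hA hπ
  rw [hp.stronglyStable_queue_iff hb hc hA hπ hq₀] at hstable
  simp only [queue_eq_queueLength] at hstable
  exact h.mem_of_hasBoundedAverage hq₀ (convex_region b) (isClosed_region b)
    (hp.isCoordinateConvex_region hb) (fun q => hp.rate_mem_region hb (π q)) hstable

theorem Valid.isSwitchingRegion (hslots : iIndepFun c μ) :
    p.IsSwitchingRegion b μ c (p.region b) where
  left _ hπ :=
    ⟨fun _ ha => ⟨ha.1, fun _ _ hA hq₀ =>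
      hp.stronglyStable_of_isSwitchingPolicy hb hc hA hπ hq₀ ha⟩,
    fun _ ha => hp.mem_region_of_stronglyStable hb hc (isArrival_const hslots ha.1) hπ.1 le_rfl
      (ha.2 _ 0 (isArrival_const hslots ha.1) fun _ => le_rfl)⟩
  right _ _ _ _ hπ hA hq₀ := hp.mem_region_of_stronglyStable hb hc hA hπ hq₀

end Stability

end Params

end IASVD

theorem mainTheorem6 (p : IASVD.Params) (hp : p.Valid) {Ω : Type*} [MeasurableSpace Ω]
    (μ : MeasureTheory.Measure Ω) [MeasureTheory.IsProbabilityMeasure μ]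
    (c : ℕ → Ω → p.Fading)
    (hslots : ProbabilityTheory.iIndepFun c μ) :
    (3 ≤ p.Nt * p.Nr → (∀ t, p.IsSlotFading .imperfect μ (c t)) →
      p.IsSwitchingRegion .imperfect μ c (p.region .imperfect)) ∧
    ((∀ t, p.IsSlotFading .perfect μ (c t)) →
      p.IsSwitchingRegion .perfect μ c (p.region .perfect)) :=
  ⟨fun h3 hc => hp.isSwitchingRegion (fun _ => h3) hc hslots,
    fun hc => hp.isSwitchingRegion (fun h => by cases h) hc hslots⟩
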